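/- Conventions. A hyperbolic space is a non-empty geodesic metric space that is Gromov hyperbolic (not necessarily proper), and all group actions on hyperbolic spaces are by isometries. Its Gromov boundary $\partial X$ is the set of equivalence classes of sequences converging at infinity, and $\Lambda(G)\subseteq\partial X$ is the set of limit points of an orbit of $G$. An action of a group $G$ on a hyperbolic space $X$ is *elliptic*, *horocyclic* or *lineal* if $|\Lambda(G)|=0$, $1$ or $2$ respectively; it is *elementary* if $|\Lambda(G)|\le 2$; a non-elementary action is *focal* if $G$ fixes a point of $\partial X$, and of *general type* otherwise. These five are the types of actions. An element $g$ is *loxodromic* if $n\mapsto g^n x$ is a quasi-isometric embedding $\mathbb{Z}\to X$ for some (equivalently, any) $x\in X$. An action is *cobounded* if $X$ is the bounded neighbourhood of an orbit. A subset $Z\subseteq X$ is *$Q$-quasiconvex* if every geodesic with endpoints in $Z$ lies in the $Q$-neighbourhood of $Z$. A group $G$ has (NL) if no element is loxodromic in any action of $G$ on a hyperbolic space, (NNE) if every action of $G$ on a hyperbolic space is elementary, and (NGT) if no action of $G$ on a hyperbolic space is of general type. For two cobounded actions of $G$ on hyperbolic spaces $A$, $B$ write $A\preceq B$ if for some $a\in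 A$, $b\in B$ and some constant $C$ we have $d(a,ga)\le C\,d(b,gb)+C$ for all $g\in G$. The poset $\mathcal{H}(G)$ of hyperbolic structures is the set of cobounded actions of $G$ on hyperbolic spaces up to coarsely $G$-equivariant quasi-isometry, ordered by $\preceq$. Let $\mathcal{H}_e(G)$, $\mathcal{H}_\ell(G)$, $\mathcal{H}_{gt}(G)$ be the sets of classes of elliptic, lineal and general type actions. $\mathcal{H}(G)$ is *trivial* if its only element is the trivial structure, that is, the class of the action of $G$ on a point. **Theorem.** Let $G$ be a group. 1. Let $G$ act on a hyperbolic space $X$, let $o\in X$ and $Q\ge 0$. Then there exist $K>0$, a hyperbolic space $Y$ with a cobounded $G$-action, and a $G$-equivariant coarsely Lipschitz map $\pi:X\to Y$ such that $\pi|_Z$ is a $(K,K)$-quasi-isometric embedding for every $Q$-quasiconvex subset $Z$ of the orbit $G\cdot o$. Moreover, there exists $D$ such that for every geodesic $[x,y]$ in $X$, the set $\pi([x,y])$ lies at Hausdorff distance at most $D$ from any geodesic in $Y$ with endpoints $\pi(x)$, $\pi(y)$. 2. If $G$ acts on a hyperbolic space $X$ and the action is not horocyclic, then there is a hyperbolic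 space $Y$ with a cobounded $G$-action of the same type as the action of $G$ on $X$. 3. - $G$ has (NGT) if and only if $\mathcal{H}_{gt}(G)=\emptyset$; - $G$ has (NNE) if and only if $\mathcal{H}(G)=\mathcal{H}_e(G)\sqcup\mathcal{H}_\ell(G)$; - $G$ has (NL) if and only if $\mathcal{H}(G)$ is trivial. -/

import Mathlib

open Set Filter Topology

universe u v w

noncomputable section

namespace HypAct

/-! ### Geodesics, quasi-isometries and hyperbolic spaces -/

/-- `γ`, restricted to `[0, d(x, y)]`, is a geodesic from `x` to `y`. -/
def IsGeodesic {X : Type v} [MetricSpace X] (γ : ℝ → X) (x y : X) : Prop :=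
  γ 0 = x ∧ γ (dist x y) = y ∧
    ∀ s ∈ Icc 0 (dist x y), ∀ t ∈ Icc 0 (dist x y), dist (γ s) (γ t) = |s - t|

/-- The set of points of a geodesic from `x` to `y` parametrized by `γ`. -/
def segment {X : Type v} [MetricSpace X] (γ : ℝ → X) (x y : X) : Set X :=
  γ '' Icc 0 (dist x y)

/-- `Z` is `Q`-quasiconvex: every geodesic with endpoints in `Z` lies in the
`Q`-neighbourhood of `Z`. -/
def IsQuasiconvex {X : Type v} [MetricSpace X] (Q : ℝ) (Z : Set X) : Prop :=
  ∀ x ∈ Z, ∀ y ∈ Z, ∀ γ : ℝ → X, IsGeodesic γ x y →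
    ∀ p ∈ segment γ x y, ∃ z ∈ Z, dist p z ≤ Q

/-- `f` is an `(L, C)`-quasi-isometric embedding. -/
def IsQIEmbedding {X : Type v} {Y : Type w} [PseudoMetricSpace X] [PseudoMetricSpace Y]
    (L C : ℝ) (f : X → Y) : Prop :=
  0 < L ∧ ∀ x y, L⁻¹ * dist x y - C ≤ dist (f x) (f y) ∧ dist (f x) (f y) ≤ L * dist x y + C

/-- `f` is a quasi-isometry. -/
def IsQuasiIsometry {X : Type v} {Y : Type w} [PseudoMetricSpace X] [PseudoMetricSpace Y]
    (f : X → Y) : Prop :=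
  ∃ L C : ℝ, IsQIEmbedding L C f ∧ ∀ y, ∃ x, dist y (f x) ≤ C

/-- `f` is coarsely Lipschitz. -/
def IsCoarselyLipschitz {X : Type v} {Y : Type w} [PseudoMetricSpace X] [PseudoMetricSpace Y]
    (f : X → Y) : Prop :=
  ∃ L : ℝ, ∀ x y, dist (f x) (f y) ≤ L * dist x y + L

/-- The Gromov product `(x | y)_o`. -/
def gromovProd {X : Type v} [MetricSpace X] (o x y : X) : ℝ :=
  (dist x o + dist y o - dist x y) / 2

/-- A hyperbolic space: a non-empty geodesic metric space that is hyperbolic in the sense of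
Gromov. -/
class IsHyperbolicSpace (X : Type v) [MetricSpace X] : Prop where
  nonempty : Nonempty X
  geodesic : ∀ x y : X, ∃ γ : ℝ → X, IsGeodesic γ x y
  hyperbolic : ∃ δ : ℝ, ∀ o x y z : X,
    min (gromovProd o x y) (gromovProd o y z) - δ ≤ gromovProd o x z

/-! ### The Gromov boundary, as classes of sequences convergent at infinity -/

/-- `(u i | v j)_o → ∞` as `i, j → ∞`. -/
def Asymptotic {X : Type v} [MetricSpace X] (a b : ℕ → X) : Prop :=
  ∀ o : X, Tendsto (fun p : ℕ × ℕ => gromovProd o (a p.1) (b p.2)) atTop atTop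

/-- The sequence `a` converges at infinity: `(a i | a j)_o → ∞` as `i, j → ∞`. -/
def ConvergesAtInfinity {X : Type v} [MetricSpace X] (a : ℕ → X) : Prop :=
  Asymptotic a a

theorem gromovProd_comm {X : Type v} [MetricSpace X] (o x y : X) :
    gromovProd o x y = gromovProd o y x := by
  unfold gromovProd
  rw [dist_comm x y]
  ring

theorem Asymptotic.symm {X : Type v} [MetricSpace X] {a b : ℕ → X} (h : Asymptotic a b) :
    Asymptotic b a := by
  intro o
  rw [tendsto_atTop]
  intro M
  obtain ⟨⟨i, j⟩, hN⟩ := eventually_atTop.1 ((h o).eventually_ge_atTop M)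
  refine eventually_atTop.2 ⟨(j, i), fun p hp => ?_⟩
  rw [gromovProd_comm]
  exact hN (p.2, p.1) ⟨hp.2, hp.1⟩

theorem Asymptotic.trans {X : Type v} [MetricSpace X] [IsHyperbolicSpace X] {a b c : ℕ → X}
    (h₁ : Asymptotic a b) (h₂ : Asymptotic b c) : Asymptotic a c := by
  intro o
  obtain ⟨δ, hδ⟩ := IsHyperbolicSpace.hyperbolic (X := X)
  rw [tendsto_atTop]
  intro M
  obtain ⟨⟨i, j⟩, hN⟩ := eventually_atTop.1 ((h₁ o).eventually_ge_atTop (M + δ))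
  obtain ⟨⟨k, l⟩, hN'⟩ := eventually_atTop.1 ((h₂ o).eventually_ge_atTop (M + δ))
  refine eventually_atTop.2 ⟨(i, l), fun p hp => ?_⟩
  have h1 : M + δ ≤ gromovProd o (a p.1) (b (max j k)) :=
    hN (p.1, max j k) ⟨hp.1, le_max_left _ _⟩
  have h2 : M + δ ≤ gromovProd o (b (max j k)) (c p.2) :=
    hN' (max j k, p.2) ⟨le_max_right _ _, hp.2⟩
  have h3 := hδ o (a p.1) (b (max j k)) (c p.2)
  have h4 := le_min h1 h2
  show M ≤ gromovProd o (a p.1) (c p.2)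
  linarith

/-- Two sequences that converge at infinity are identified when they are asymptotic. -/
instance boundarySetoid (X : Type v) [MetricSpace X] [IsHyperbolicSpace X] :
    Setoid {a : ℕ → X // ConvergesAtInfinity a} where
  r a b := Asymptotic a.1 b.1
  iseqv := ⟨fun a => a.2, fun h => h.symm, fun h₁ h₂ => h₁.trans h₂⟩

/-- The Gromov boundary `∂X`. -/
def Boundary (X : Type v) [MetricSpace X] [IsHyperbolicSpace X] : Type v :=
  Quotient (boundarySetoid X)

section Actions

variable (G : Type u) [Group G] (X : Type v) [MetricSpace X] [MulAction G X] [IsIsometricSMul G X]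

variable {G X} in
theorem Asymptotic.smul {a b : ℕ → X} (h : Asymptotic a b) (g : G) :
    Asymptotic (fun n => g • a n) (fun n => g • b n) := by
  intro o
  have key : ∀ x y : X, gromovProd o (g • x) (g • y) = gromovProd (g⁻¹ • o) x y := by
    intro x y
    have h1 : ∀ x : X, dist (g • x) o = dist x (g⁻¹ • o) := fun x => by
      rw [← dist_smul g x (g⁻¹ • o), smul_inv_smul]
    unfold gromovProd
    rw [h1, h1, dist_smul]
  simpa only [key] using h (g⁻¹ • o)

variable [IsHyperbolicSpace X]

/-- The action of `G` on the boundary induced by an isometric action on the space. -/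
instance boundaryAction : MulAction G (Boundary X) where
  smul g := Quotient.map (fun a => ⟨fun n => g • a.1 n, Asymptotic.smul a.2 g⟩)
    (fun _ _ h => Asymptotic.smul h g)
  one_smul ξ := by
    induction ξ using Quotient.inductionOn with
    | h a =>
      refine congrArg (Quotient.mk (boundarySetoid X)) (Subtype.ext (funext fun n => ?_))
      exact one_smul G (a.1 n)
  mul_smul g h ξ := by
    induction ξ using Quotient.inductionOn with
    | h a =>
      refine congrArg (Quotient.mk (boundarySetoid X)) (Subtype.ext (funext fun n => ?_))
      exact mul_smul g h (a.1 n)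

/-- The limit set `Λ(G) ⊆ ∂X`: the boundary points that are limits of sequences of points of a
`G`-orbit. (It is the same for every orbit.) -/
def limitSet : Set (Boundary X) :=
  {ξ | ∃ (x : X) (g : ℕ → G) (h : ConvergesAtInfinity fun n => g n • x),
    ξ = Quotient.mk (boundarySetoid X) ⟨fun n => g n • x, h⟩}

/-! ### Types of actions -/

/-- The action is elementary: `|Λ(G)| ≤ 2`. -/
def IsElementary : Prop := (limitSet G X).encard ≤ 2

/-- `G` fixes a point of `∂X`. -/
def FixesBoundaryPoint : Prop := ∃ ξ : Boundary X, ∀ g : G, g • ξ = ξ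

/-- The five types of isometric actions on hyperbolic spaces. -/
inductive ActionType : Type where
  | elliptic
  | horocyclic
  | lineal
  | focal
  | generalType

/-- The action of `G` on the hyperbolic space `X` is of the given type. -/
def HasType : ActionType → Prop
  | .elliptic => (limitSet G X).encard = 0
  | .horocyclic => (limitSet G X).encard = 1
  | .lineal => (limitSet G X).encard = 2
  | .focal => ¬ IsElementary G X ∧ FixesBoundaryPoint G X
  | .generalType => ¬ IsElementary G X ∧ ¬ FixesBoundaryPoint G X

end Actions

/-- The action of `G` on `X` is cobounded. -/
def IsCobounded (G : Type u) [Group G] (X : Type v) [MetricSpace X] [MulAction G X] : Prop :=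
  ∃ (x : X) (R : ℝ), ∀ y : X, ∃ g : G, dist y (g • x) ≤ R

/-- `g` acts on `X` as a loxodromic isometry: `n ↦ gⁿ x` is a quasi-isometric embedding of `ℤ`
for some `x` (equivalently, for every `x`). -/
def IsLoxodromic {G : Type u} [Group G] (X : Type v) [MetricSpace X] [MulAction G X] (g : G) :
    Prop :=
  ∃ (x : X) (L C : ℝ), IsQIEmbedding L C (fun n : ℤ => g ^ n • x)

/-! ### The properties (NL), (NNE), (NGT) -/

/-- Property (NL): no isometric action of `G` on a hyperbolic space has a loxodromic element. -/
def NL (G : Type u) [Group G] : Prop :=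
  ∀ (X : Type v) [MetricSpace X] [MulAction G X] [IsIsometricSMul G X] [IsHyperbolicSpace X]
    (g : G), ¬ IsLoxodromic X g

/-- Property (NNE): `G` has no non-elementary isometric action on a hyperbolic space. -/
def NNE (G : Type u) [Group G] : Prop :=
  ∀ (X : Type v) [MetricSpace X] [MulAction G X] [IsIsometricSMul G X] [IsHyperbolicSpace X],
    IsElementary G X

/-- Property (NGT): `G` has no isometric action of general type on a hyperbolic space. -/
def NGT (G : Type u) [Group G] : Prop :=
  ∀ (X : Type v) [MetricSpace X] [MulAction G X] [IsIsometricSMul G X] [IsHyperbolicSpace X],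
    ¬ HasType G X .generalType

/-! ### The poset of hyperbolic structures -/

/-- A cobounded isometric action of `G` on a hyperbolic space. -/
structure CoboundedAction (G : Type u) [Group G] where
  carrier : Type v
  [metric : MetricSpace carrier]
  [action : MulAction G carrier]
  [isometric : IsIsometricSMul G carrier]
  [hyperbolic : IsHyperbolicSpace carrier]
  cobounded : IsCobounded G carrier

attribute [instance] CoboundedAction.metric CoboundedAction.action CoboundedAction.isometric
  CoboundedAction.hyperbolic

namespace CoboundedAction

variable {G : Type u} [Group G]

/-- `A ≼ B`: up to additive and multiplicative constants, displacements in `A` are bounded by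
displacements in `B`. -/
def Dominated (A B : CoboundedAction.{u, v} G) : Prop :=
  ∃ (a : A.carrier) (b : B.carrier) (C : ℝ), ∀ g : G, dist a (g • a) ≤ C * dist b (g • b) + C

/-- `A` and `B` are equivalent: there is a coarsely `G`-equivariant quasi-isometry. -/
def Equivalent (A B : CoboundedAction.{u, v} G) : Prop :=
  ∃ f : A.carrier → B.carrier, IsQuasiIsometry f ∧
    ∀ x : A.carrier, ∃ C : ℝ, ∀ g : G, dist (f (g • x)) (g • f x) ≤ C

theorem Dominated.forall {A B : CoboundedAction.{u, v} G} (h : Dominated A B)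
    (a' : A.carrier) (b' : B.carrier) :
    ∃ C : ℝ, 0 < C ∧ ∀ g : G, dist a' (g • a') ≤ C * dist b' (g • b') + C := by
  obtain ⟨a, b, C, h⟩ := h
  have d1 : 0 ≤ dist a a' := dist_nonneg
  have d2 : 0 ≤ dist b b' := dist_nonneg
  have c0 : 0 ≤ |C| := abs_nonneg C
  refine ⟨|C| + 1 + 2 * dist a a' + |C| * (2 * dist b b'), by positivity, fun g => ?_⟩
  have h1 : dist a' (g • a') ≤ dist a a' + dist a (g • a) + dist a a' := by
    have := dist_triangle4 a' a (g • a) (g • a')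
    rwa [dist_smul, dist_comm a' a] at this
  have h2 : dist b (g • b) ≤ dist b b' + dist b' (g • b') + dist b b' := by
    have := dist_triangle4 b b' (g • b') (g • b)
    rwa [dist_smul, dist_comm b' b] at this
  have h3 : C * dist b (g • b) ≤ |C| * dist b (g • b) :=
    mul_le_mul_of_nonneg_right (le_abs_self C) dist_nonneg
  have h4 : |C| * dist b (g • b) ≤ |C| * (dist b b' + dist b' (g • b') + dist b b') :=
    mul_le_mul_of_nonneg_left h2 c0
  have h5 := h g
  have h6 := le_abs_self C
  have h7 : 0 ≤ (1 + 2 * dist a a' + |C| * (2 * dist b b')) * dist b' (g • b') := by positivity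
  nlinarith

theorem Dominated.refl (A : CoboundedAction.{u, v} G) : Dominated A A := by
  obtain ⟨a⟩ := IsHyperbolicSpace.nonempty (X := A.carrier)
  exact ⟨a, a, 1, fun g => by linarith⟩

theorem Dominated.trans {A B D : CoboundedAction.{u, v} G} (h₁ : Dominated A B)
    (h₂ : Dominated B D) : Dominated A D := by
  obtain ⟨a⟩ := IsHyperbolicSpace.nonempty (X := A.carrier)
  obtain ⟨b⟩ := IsHyperbolicSpace.nonempty (X := B.carrier)
  obtain ⟨d⟩ := IsHyperbolicSpace.nonempty (X := D.carrier)
  obtain ⟨C, hC, h⟩ := h₁.forall a b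
  obtain ⟨C', hC', h'⟩ := h₂.forall b d
  refine ⟨a, d, C * C' + C, fun g => ?_⟩
  have h1 := h g
  have h2 := mul_le_mul_of_nonneg_left (h' g) hC.le
  have h3 : 0 ≤ C * dist d (g • d) := by positivity
  nlinarith

theorem equivalent_iff (A B : CoboundedAction.{u, v} G) :
    Equivalent A B ↔ Dominated A B ∧ Dominated B A := by
  constructor
  · rintro ⟨f, ⟨L, C, ⟨hL, hf⟩, -⟩, hG⟩
    obtain ⟨a⟩ := IsHyperbolicSpace.nonempty (X := A.carrier)
    obtain ⟨E, hE⟩ := hG a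
    have hE0 : 0 ≤ E := dist_nonneg.trans (hE 1)
    have hC0 : 0 ≤ C := by
      have := (hf a a).2
      simpa using this
    refine ⟨⟨a, f a, L + L * (C + E), fun g => ?_⟩, ⟨f a, a, L + (C + E), fun g => ?_⟩⟩
    · have h1 := (hf a (g • a)).1
      have h2 : dist (f a) (f (g • a)) ≤ dist (f a) (g • f a) + E := by
        have := dist_triangle (f a) (g • f a) (f (g • a))
        rw [dist_comm (g • f a)] at this
        linarith [hE g]
      have h3 : L⁻¹ * dist a (g • a) ≤ dist (f a) (g • f a) + E + C := by linarith
      have h4 := mul_le_mul_of_nonneg_left h3 hL.le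
      rw [mul_inv_cancel_left₀ hL.ne'] at h4
      have h5 : 0 ≤ L * (C + E) * dist (f a) (g • f a) := by positivity
      nlinarith
    · have h1 := (hf a (g • a)).2
      have h2 := dist_triangle (f a) (f (g • a)) (g • f a)
      have h3 := hE g
      have h4 : 0 ≤ (C + E) * dist a (g • a) := by positivity
      nlinarith
  · rintro ⟨hAB, hBA⟩
    obtain ⟨a, R, hR⟩ := A.cobounded
    obtain ⟨b, S, hS⟩ := B.cobounded
    obtain ⟨C, hC, h⟩ := hAB.forall a b
    obtain ⟨C', hC', h'⟩ := hBA.forall b a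
    have hR0 : 0 ≤ R := by obtain ⟨g, hg⟩ := hR a; exact dist_nonneg.trans hg
    have hS0 : 0 ≤ S := by obtain ⟨g, hg⟩ := hS b; exact dist_nonneg.trans hg
    choose k hk using hR
    have tA : ∀ (p q : G), dist (p • a) (q • a) = dist a ((p⁻¹ * q) • a) := fun p q => by
      rw [← dist_smul p a, smul_smul, mul_inv_cancel_left]
    have tB : ∀ (p q : G), dist (p • b) (q • b) = dist b ((p⁻¹ * q) • b) := fun p q => by
      rw [← dist_smul p b, smul_smul, mul_inv_cancel_left]
    have lip : ∀ p q : G, dist (p • b) (q • b) ≤ C' * dist (p • a) (q • a) + C' := fun p q => by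
      rw [tA, tB]; exact h' _
    have lip' : ∀ p q : G, dist (p • a) (q • a) ≤ C * dist (p • b) (q • b) + C := fun p q => by
      rw [tA, tB]; exact h _
    have up : ∀ x y, dist (k x • a) (k y • a) ≤ dist x y + 2 * R := fun x y => by
      have := dist_triangle4 (k x • a) x y (k y • a)
      rw [dist_comm (k x • a) x] at this
      linarith [hk x, hk y]
    have lo : ∀ x y, dist x y ≤ dist (k x • a) (k y • a) + 2 * R := fun x y => by
      have := dist_triangle4 x (k x • a) (k y • a) y
      rw [dist_comm (k y • a) y] at this
      linarith [hk x, hk y]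
    refine ⟨fun x => k x • b, ⟨C + C', 1 + 2 * R * C⁻¹ + (C' * (2 * R) + C') + (C' * R + C' + S),
      ⟨by positivity, fun x y => ⟨?_, ?_⟩⟩, fun y => ?_⟩, fun x => ⟨C' * (2 * R) + C', fun g => ?_⟩⟩
    · have h1 := lo x y
      have h2 := lip' (k x) (k y)
      have h3 : (C + C')⁻¹ * dist x y ≤ C⁻¹ * dist x y :=
        mul_le_mul_of_nonneg_right (inv_anti₀ hC (by linarith)) dist_nonneg
      have h4 : C⁻¹ * dist x y ≤ C⁻¹ * (C * dist (k x • b) (k y • b) + C + 2 * R) :=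
        mul_le_mul_of_nonneg_left (by linarith) (inv_nonneg.2 hC.le)
      have h5 : C⁻¹ * (C * dist (k x • b) (k y • b) + C + 2 * R)
          = dist (k x • b) (k y • b) + 1 + 2 * R * C⁻¹ := by
        field_simp
      have h6 : 0 ≤ C' * (2 * R) + C' := by positivity
      have h7 : 0 ≤ C' * R + C' + S := by positivity
      linarith
    · have h1 := lip (k x) (k y)
      have h2 := mul_le_mul_of_nonneg_left (up x y) hC'.le
      have h3 : 0 ≤ C * dist x y := by positivity
      have h4 : 0 ≤ 2 * R * C⁻¹ := by positivity
      have h5 : 0 ≤ C' * R + C' + S := by positivity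
      show dist (k x • b) (k y • b) ≤ _
      linarith
    · obtain ⟨g, hg⟩ := hS y
      refine ⟨g • a, ?_⟩
      have h1 := dist_triangle y (g • b) (k (g • a) • b)
      have h2 := lip g (k (g • a))
      have h3 := mul_le_mul_of_nonneg_left (hk (g • a)) hC'.le
      have h4 : 0 ≤ 2 * R * C⁻¹ := by positivity
      have h5 : 0 ≤ C' * (2 * R) + C' := by positivity
      show dist y (k (g • a) • b) ≤ _
      linarith
    · show dist (k (g • x) • b) (g • k x • b) ≤ _
      rw [smul_smul]
      have h1 := lip (k (g • x)) (g * k x)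
      have h2 : dist (k (g • x) • a) ((g * k x) • a) ≤ 2 * R := by
        have h3 := dist_triangle (k (g • x) • a) (g • x) ((g * k x) • a)
        have h4 : dist (g • x) ((g * k x) • a) = dist x (k x • a) := by
          rw [mul_smul, dist_smul]
        rw [h4, dist_comm (k (g • x) • a) (g • x)] at h3
        linarith [hk x, hk (g • x)]
      have h3 := mul_le_mul_of_nonneg_left h2 hC'.le
      linarith

instance setoid (G : Type u) [Group G] : Setoid (CoboundedAction.{u, v} G) where
  r := Equivalent
  iseqv := ⟨fun A => (equivalent_iff A A).2 ⟨.refl A, .refl A⟩,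
    fun {A B} h => (equivalent_iff B A).2 ((equivalent_iff A B).1 h).symm,
    fun {A B D} h₁ h₂ => by
      rw [equivalent_iff] at *
      exact ⟨h₁.1.trans h₂.1, h₂.2.trans h₁.2⟩⟩

end CoboundedAction

/-- The set `𝓗(G)` of hyperbolic structures on `G`: equivalence classes of cobounded isometric
actions on hyperbolic spaces. -/
def HyperbolicStructures (G : Type u) [Group G] : Type (max u (v + 1)) :=
  Quotient (CoboundedAction.setoid.{u, v} G)

namespace HyperbolicStructures

/-- The partial order of `𝓗(G)`, induced by domination. -/
instance (G : Type u) [Group G] : PartialOrder (HyperbolicStructures.{u, v} G) where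
  le := Quotient.lift₂ CoboundedAction.Dominated fun A B A' B' hA hB => by
    have hA := (CoboundedAction.equivalent_iff A A').1 hA
    have hB := (CoboundedAction.equivalent_iff B B').1 hB
    exact propext ⟨fun h => (hA.2.trans h).trans hB.1, fun h => (hA.1.trans h).trans hB.2⟩
  le_refl c := by
    induction c using Quotient.inductionOn with
    | h A => exact CoboundedAction.Dominated.refl A
  le_trans c d e := by
    induction c using Quotient.inductionOn with
    | h A =>
      induction d using Quotient.inductionOn with
      | h B =>
        induction e using Quotient.inductionOn with
        | h D => exact CoboundedAction.Dominated.trans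
  le_antisymm c d := by
    induction c using Quotient.inductionOn with
    | h A =>
      induction d using Quotient.inductionOn with
      | h B =>
        exact fun h₁ h₂ => Quotient.sound ((CoboundedAction.equivalent_iff A B).2 ⟨h₁, h₂⟩)

/-- The structures of a given type, that is, those represented by an action of this type:
`𝓗_e(G)`, `𝓗_ℓ(G)`, `𝓗_qp(G)` and `𝓗_gt(G)` for elliptic, lineal, focal and general type. -/
def ofType (G : Type u) [Group G] (t : ActionType) : Set (HyperbolicStructures.{u, v} G) :=
  {c | ∃ A : CoboundedAction.{u, v} G,
    c = Quotient.mk (CoboundedAction.setoid G) A ∧ HasType G A.carrier t}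

end HyperbolicStructures

theorem point_isHyperbolicSpace : IsHyperbolicSpace PUnit.{v + 1} where
  nonempty := ⟨PUnit.unit⟩
  geodesic x y := ⟨fun _ => PUnit.unit, rfl, rfl, fun s hs t ht => by
    simp only [dist_self, Icc_self, mem_singleton_iff] at hs ht
    simp [hs, ht]⟩
  hyperbolic := ⟨0, fun o x y z => by simp [gromovProd]⟩

/-- The trivial structure of `𝓗(G)`: the class of the action of `G` on a point. -/
def trivialStructure (G : Type u) [Group G] : HyperbolicStructures.{u, v} G :=
  Quotient.mk (CoboundedAction.setoid G)
    { carrier := PUnit.{v + 1}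
      isometric := ⟨fun _ _ _ => rfl⟩
      hyperbolic := point_isHyperbolicSpace
      cobounded := ⟨PUnit.unit, 0, fun _ => ⟨1, (dist_self _).le⟩⟩ }

end HypAct

end

/-! Let `κ` be a four-point constant of `X`. The space `Y` is obtained by collapsing everything that
is far from the orbit of `o`: two points are joined by one jump if they are at distance at most 1,
or if some geodesic between them stays at distance more than `R = Q + 4κ` from the orbit. The number
of jumps is a `G`-invariant pseudo-distance. It is cobounded because a point far from the orbit
reaches a bounded neighbourhood of it in one jump.

Hyperbolicity comes from `IsJump.exists_jumpDist_add_le`: geodesics of `X` are coarsely geodesic for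
the jump distance. This is the exponential divergence argument of the Morse lemma. A chain of `n`
jumps passes within `O(log n)` of the geodesic, while a point of the geodesic at maximal depth `D`
from a shortest chain can be bypassed, at distance `D`, by about `8D` jumps; so `D` is bounded.
Coarse betweenness, and with it the four-point condition, then passes from `X` to the jump distance.
The actual geodesic space `Y` is the injective hull of this pseudo-distance, which is geodesic,
functorial and, under hyperbolicity, at bounded distance from the image of `X`.

Distances survive along quasiconvex subsets of the orbit: if `[z, z']` stays `Q`-close to the orbit,
one jump advances the coordinate `gromovProd z · z'` by at most `κ + 1`, since a jump that advanced
more would have its geodesic pass close to `[z, z']` and hence to the orbit.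

For the types, fix a loxodromic `g`. The action is elementary iff every `k` preserves the pair of
endpoints of `g`, and it has a fixed boundary point iff some endpoint of `g` is fixed by every `k`.
Each such universal statement is decided by one well-chosen `k`, and `k` sends one endpoint to
another iff rays of `k g k⁻¹` and `g` through `o` are close. Hence it suffices to choose `Q` so that
the unions of axes for three elements `k` are `Q`-quasiconvex. Without loxodromics, any two long
displacements have a large Gromov product, so the limit set has at most one point; if moreover the
action is cobounded, a midpoint argument shows that the space is bounded. The statements about the
poset follow. -/

noncomputable section

namespace HypAct

/-! ### The four-point condition and geodesics -/

/-- The four-point condition for a function of two variables, with additive constant `κ`. -/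
def FourPoint {X : Type v} (κ : ℝ) (ρ : X → X → ℝ) : Prop :=
  ∀ x y z w : X, ρ x z + ρ y w ≤ ρ x y + ρ z w + κ ∨ ρ x z + ρ y w ≤ ρ y z + ρ x w + κ

/-- Hyperbolicity with constant `δ` in terms of Gromov products. -/
def IsGromovHyp (X : Type v) [MetricSpace X] (δ : ℝ) : Prop :=
  ∀ o x y z : X, min (gromovProd o x y) (gromovProd o y z) - δ ≤ gromovProd o x z

section

variable {X : Type v} [MetricSpace X]

theorem IsGromovHyp.nonneg {δ : ℝ} (h : IsGromovHyp X δ) (x : X) : 0 ≤ δ := by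
  have := h x x x x
  simp [gromovProd] at this
  exact this

theorem IsGromovHyp.le_or {δ : ℝ} (h : IsGromovHyp X δ) (o x y z : X) :
    gromovProd o x y ≤ gromovProd o x z + δ ∨ gromovProd o y z ≤ gromovProd o x z + δ := by
  rcases min_le_iff.1 (sub_le_iff_le_add.1 (h o x y z)) with h | h
  · exact Or.inl h
  · exact Or.inr h

theorem IsGromovHyp.fourPoint {δ : ℝ} (h : IsGromovHyp X δ) :
    FourPoint (2 * δ) (dist : X → X → ℝ) := by
  intro x y z w
  have := h.le_or w x y z
  unfold gromovProd at this
  rcases this with h | h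
  · left; linarith
  · right; linarith

theorem FourPoint.isGromovHyp {κ : ℝ} (h : FourPoint κ (dist : X → X → ℝ)) :
    IsGromovHyp X (κ / 2) := by
  intro o x y z
  rw [sub_le_iff_le_add, min_le_iff]
  unfold gromovProd
  rcases h x y z o with h | h
  · left; linarith
  · right; linarith

theorem exists_isGromovHyp (X : Type v) [MetricSpace X] [IsHyperbolicSpace X] :
    ∃ δ : ℝ, 0 ≤ δ ∧ IsGromovHyp X δ := by
  obtain ⟨δ, h⟩ := IsHyperbolicSpace.hyperbolic (X := X)
  obtain ⟨x⟩ := IsHyperbolicSpace.nonempty (X := X)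
  exact ⟨δ, IsGromovHyp.nonneg h x, h⟩

theorem IsGeodesic.dist_left {γ : ℝ → X} {x y : X} (h : IsGeodesic γ x y) {t : ℝ}
    (ht : t ∈ Icc 0 (dist x y)) : dist x (γ t) = t := by
  have := h.2.2 0 ⟨le_rfl, dist_nonneg⟩ t ht
  rw [h.1] at this
  rw [this, zero_sub, abs_neg, abs_of_nonneg ht.1]

theorem IsGeodesic.dist_right {γ : ℝ → X} {x y : X} (h : IsGeodesic γ x y) {t : ℝ}
    (ht : t ∈ Icc 0 (dist x y)) : dist (γ t) y = dist x y - t := by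
  have := h.2.2 t ht (dist x y) ⟨dist_nonneg, le_rfl⟩
  rw [h.2.1] at this
  rw [this, abs_sub_comm, abs_of_nonneg (by linarith [ht.2])]

/-- The part of a geodesic between two parameters is a geodesic. -/
theorem IsGeodesic.sub {γ : ℝ → X} {x y : X} (h : IsGeodesic γ x y) {s t : ℝ}
    (hs : 0 ≤ s) (hst : s ≤ t) (ht : t ≤ dist x y) :
    dist (γ s) (γ t) = t - s ∧ IsGeodesic (fun r => γ (s + r)) (γ s) (γ t) := by
  have hd : dist (γ s) (γ t) = t - s := by
    rw [h.2.2 s ⟨hs, hst.trans ht⟩ t ⟨hs.trans hst, ht⟩, abs_sub_comm, abs_of_nonneg (by linarith)]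
  refine ⟨hd, by simp, by simp [hd], fun a ha b hb => ?_⟩
  rw [hd] at ha hb
  rw [h.2.2 (s + a) ⟨by linarith [ha.1], by linarith [ha.2]⟩ (s + b)
    ⟨by linarith [hb.1], by linarith [hb.2]⟩]
  congr 1; ring

theorem IsGeodesic.symm {γ : ℝ → X} {x y : X} (h : IsGeodesic γ x y) :
    IsGeodesic (fun t => γ (dist x y - t)) y x := by
  refine ⟨by simpa using h.2.1, ?_, fun a ha b hb => ?_⟩
  · simpa [dist_comm y x] using h.1
  · rw [dist_comm y x] at ha hb
    rw [h.2.2 _ ⟨by linarith [ha.2], by linarith [ha.1]⟩ _ ⟨by linarith [hb.2], by linarith [hb.1]⟩,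
      abs_sub_comm]
    congr 1; ring

theorem segment_symm {γ : ℝ → X} {x y : X} :
    segment (fun t => γ (dist x y - t)) y x = segment γ x y := by
  unfold segment
  rw [dist_comm y x]
  ext p
  constructor
  · rintro ⟨t, ht, rfl⟩
    exact ⟨dist x y - t, ⟨by linarith [ht.2], by linarith [ht.1]⟩, rfl⟩
  · rintro ⟨t, ht, rfl⟩
    exact ⟨dist x y - t, ⟨by linarith [ht.2], by linarith [ht.1]⟩, by simp⟩

theorem IsGeodesic.left_mem {γ : ℝ → X} {x y : X} (h : IsGeodesic γ x y) : x ∈ segment γ x y :=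
  ⟨0, ⟨le_rfl, dist_nonneg⟩, h.1⟩

theorem IsGeodesic.right_mem {γ : ℝ → X} {x y : X} (h : IsGeodesic γ x y) : y ∈ segment γ x y :=
  ⟨dist x y, ⟨dist_nonneg, le_rfl⟩, h.2.1⟩

/-- The distance from any point to a point of a geodesic is determined, up to a bounded error, by
the distances to the endpoints. -/
theorem IsGeodesic.dist_le_or {κ : ℝ} (hX : FourPoint κ (dist : X → X → ℝ)) {γ : ℝ → X} {x y : X}
    (h : IsGeodesic γ x y) {t : ℝ} (ht : t ∈ Icc 0 (dist x y)) (m : X) :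
    dist m (γ t) ≤ dist x m - t + κ ∨ dist m (γ t) ≤ dist m y - (dist x y - t) + κ := by
  have h1 := h.dist_left ht
  have h2 := h.dist_right ht
  rcases hX x m y (γ t) with h | h
  · left; rw [dist_comm y (γ t)] at h; linarith
  · right; linarith

/-- A point that is coarsely between `x` and `y` is close to every geodesic from `x` to `y`. -/
theorem IsGeodesic.exists_near {κ : ℝ} (hX : FourPoint κ (dist : X → X → ℝ)) {γ : ℝ → X} {x y : X}
    (h : IsGeodesic γ x y) {m : X} {c : ℝ} (hm : dist x m + dist m y ≤ dist x y + c) (hκ : 0 ≤ κ) :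
    ∃ p ∈ segment γ x y, dist m p ≤ c + κ := by
  have hc : 0 ≤ c := by linarith [dist_triangle x m y]
  rcases le_total (dist x m) (dist x y) with h1 | h1
  · refine ⟨_, ⟨dist x m, ⟨dist_nonneg, h1⟩, rfl⟩, ?_⟩
    rcases h.dist_le_or hX (t := dist x m) ⟨dist_nonneg, h1⟩ m with h2 | h2 <;> linarith
  · exact ⟨y, h.right_mem, by linarith⟩

/-- Geodesic triangles are thin. -/
theorem IsGeodesic.thin {κ : ℝ} (hX : FourPoint κ (dist : X → X → ℝ)) {γ : ℝ → X} {x z : X}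
    (h : IsGeodesic γ x z) {p : X} (hp : p ∈ segment γ x z) (y : X) :
    dist x p + dist p y ≤ dist x y + κ ∨ dist y p + dist p z ≤ dist y z + κ := by
  obtain ⟨t, ht, rfl⟩ := hp
  have h1 := h.dist_left ht
  have h2 := h.dist_right ht
  rcases h.dist_le_or hX ht y with h3 | h3
  · left; rw [dist_comm (γ t) y]; linarith
  · right; linarith

theorem IsGeodesic.dist_add {γ : ℝ → X} {x y p : X} (h : IsGeodesic γ x y)
    (hp : p ∈ segment γ x y) : dist x p + dist p y = dist x y := by
  obtain ⟨t, ht, rfl⟩ := hp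
  rw [h.dist_left ht, h.dist_right ht]; ring

end

/-! ### The injective hull of an invariant pseudo-distance -/

/-- A pseudo-distance on a `G`-set that is invariant under the action. -/
structure InvariantDist (G : Type u) [Group G] (X : Type v) [MulAction G X] where
  /-- the pseudo-distance -/
  d : X → X → ℝ
  self : ∀ x, d x x = 0
  comm : ∀ x y, d x y = d y x
  triangle : ∀ x y z, d x z ≤ d x y + d y z
  smul : ∀ (g : G) x y, d (g • x) (g • y) = d x y

namespace InvariantDist

variable {G : Type u} [Group G] {X : Type v} [MulAction G X] (P : InvariantDist G X)

theorem nonneg (x y : X) : 0 ≤ P.d x y := by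
  have h1 := P.triangle x y x
  rw [P.self, P.comm y x] at h1
  linarith

/-- `f` dominates the pseudo-distance: `d x y ≤ f x + f y`. -/
def Dominating (f : X → ℝ) : Prop := ∀ x y, P.d x y ≤ f x + f y

/-- The injective hull: the extremal functions on `X`. -/
@[ext] structure Hull where
  /-- the underlying function -/
  toFun : X → ℝ
  dominating : P.Dominating toFun
  extremal : ∀ x, ∀ ε > 0, ∃ y, toFun x + toFun y < P.d x y + ε

variable {P}

theorem Dominating.nonneg {f : X → ℝ} (h : P.Dominating f) (x : X) : 0 ≤ f x := by
  have := h x x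
  rw [P.self] at this
  linarith

namespace Hull

/-- Extremality gives a partner `y` with `f x` nearly `d x y - f y`; domination at `z, y` bounds
this. So extremal functions are 1-Lipschitz. -/
theorem le_add (f : P.Hull) (x z : X) : f.1 x ≤ P.d x z + f.1 z := by
  refine le_of_forall_pos_lt_add fun ε hε => ?_
  obtain ⟨y, hy⟩ := f.extremal x ε hε
  have h1 := P.triangle x z y
  have h2 := f.dominating z y
  linarith

/-- The bound is uniform in `x`, so the supremum defining the distance is a genuine one and not the
default value of `⨆`. -/
theorem abs_sub_le_add (f g : P.Hull) (x z : X) : |f.1 x - g.1 x| ≤ f.1 z + g.1 z := by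
  have h1 := f.le_add x z
  have h2 := g.le_add x z
  have h3 := f.dominating x z
  have h4 := g.dominating x z
  rw [abs_le]
  constructor <;> linarith

theorem bddAbove (f g : P.Hull) : BddAbove (range fun x => |f.1 x - g.1 x|) := by
  rcases isEmpty_or_nonempty X with hX | ⟨⟨z⟩⟩
  · exact ⟨0, by rintro _ ⟨x, -⟩; exact hX.elim x⟩
  · exact ⟨f.1 z + g.1 z, by rintro _ ⟨x, rfl⟩; exact abs_sub_le_add f g x z⟩

/-- The supremum distance. -/
instance : MetricSpace P.Hull where
  dist f g := ⨆ x, |f.1 x - g.1 x|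
  dist_self f := by simp
  dist_comm f g := by simp only [abs_sub_comm]
  dist_triangle f g h := by
    refine Real.iSup_le (fun x => ?_) (add_nonneg (Real.iSup_nonneg fun _ => abs_nonneg _)
      (Real.iSup_nonneg fun _ => abs_nonneg _))
    exact (abs_sub_le _ (g.1 x) _).trans
      (add_le_add (le_ciSup (bddAbove f g) x) (le_ciSup (bddAbove g h) x))
  eq_of_dist_eq_zero {f g} h := by
    refine Hull.ext (funext fun x => ?_)
    have h1 : |f.1 x - g.1 x| ≤ 0 := (le_ciSup (bddAbove f g) x).trans_eq h
    exact sub_eq_zero.1 (abs_nonpos_iff.1 h1)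

theorem dist_le {f g : P.Hull} {c : ℝ} (hc : 0 ≤ c) (h : ∀ x, |f.1 x - g.1 x| ≤ c) :
    dist f g ≤ c :=
  Real.iSup_le h hc

theorem abs_sub_le_dist (f g : P.Hull) (x : X) : |f.1 x - g.1 x| ≤ dist f g :=
  le_ciSup (bddAbove f g) x

instance : MulAction G P.Hull where
  smul g f := ⟨fun x => f.1 (g⁻¹ • x), fun x y => by
    have := f.dominating (g⁻¹ • x) (g⁻¹ • y)
    rwa [P.smul] at this, fun x ε hε => by
    obtain ⟨y, hy⟩ := f.extremal (g⁻¹ • x) ε hε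
    refine ⟨g • y, ?_⟩
    rw [← P.smul g, smul_inv_smul] at hy
    simpa only [inv_smul_smul] using hy⟩
  one_smul f := Hull.ext (funext fun x => by
    show f.1 ((1 : G)⁻¹ • x) = f.1 x
    simp)
  mul_smul g h f := Hull.ext (funext fun x => by
    show f.1 ((g * h)⁻¹ • x) = f.1 (h⁻¹ • g⁻¹ • x)
    rw [mul_inv_rev, mul_smul])

theorem smul_apply (g : G) (f : P.Hull) (x : X) : (g • f).1 x = f.1 (g⁻¹ • x) := rfl

instance : IsIsometricSMul G P.Hull where
  isometry_smul g := by
    refine Isometry.of_dist_eq fun f f' => le_antisymm ?_ ?_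
    · exact dist_le dist_nonneg fun x => abs_sub_le_dist f f' (g⁻¹ • x)
    · refine dist_le dist_nonneg fun x => ?_
      have := abs_sub_le_dist (g • f) (g • f') (g • x)
      simpa [smul_apply] using this

variable (P) in
/-- The canonical map to the injective hull. -/
def of (x : X) : P.Hull :=
  ⟨fun y => P.d x y, fun y z => by simpa only [P.comm y x] using P.triangle y x z,
    fun y ε hε => ⟨x, by
      show P.d x y + P.d x x < _
      rw [P.self, P.comm y x]; linarith⟩⟩

theorem of_apply (x y : X) : (of P x).1 y = P.d x y := rfl

theorem dist_of (x y : X) : dist (of P x) (of P y) = P.d x y := by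
  refine le_antisymm (dist_le (P.nonneg x y) fun z => ?_) ?_
  · rw [of_apply, of_apply, abs_le]
    have h1 := P.triangle x y z
    have h2 := P.triangle y x z
    rw [P.comm y x] at h2
    constructor <;> linarith
  · have := abs_sub_le_dist (of P x) (of P y) y
    rw [of_apply, of_apply, P.self, sub_zero] at this
    exact (le_abs_self _).trans this

theorem smul_of (g : G) (x : X) : of P (g • x) = g • of P x := by
  refine Hull.ext (funext fun y => ?_)
  rw [smul_apply, of_apply, of_apply, ← P.smul g⁻¹, inv_smul_smul]

end Hull

/-! The retraction of the dominating functions onto the injective hull. -/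

variable (P) in
/-- The smallest function `k` with `d x y ≤ k x + f y`. -/
def conj (f : X → ℝ) (x : X) : ℝ := ⨆ y, (P.d x y - f y)

variable (P) in
/-- The average of a function and its conjugate. -/
def average (f : X → ℝ) (x : X) : ℝ := (f x + P.conj f x) / 2

theorem Dominating.bddAbove {f : X → ℝ} (h : P.Dominating f) (x : X) :
    BddAbove (range fun y => P.d x y - f y) :=
  ⟨f x, by rintro _ ⟨y, rfl⟩; linarith [h x y]⟩

theorem Dominating.sub_le_conj {f : X → ℝ} (h : P.Dominating f) (x y : X) :
    P.d x y - f y ≤ P.conj f x :=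
  le_ciSup (h.bddAbove x) y

theorem Dominating.conj_le {f : X → ℝ} (h : P.Dominating f) (x : X) : P.conj f x ≤ f x := by
  have : Nonempty X := ⟨x⟩
  exact ciSup_le fun y => by linarith [h x y]

theorem Dominating.average_le {f : X → ℝ} (h : P.Dominating f) (x : X) : P.average f x ≤ f x := by
  have := h.conj_le x
  unfold average
  linarith

theorem Dominating.average {f : X → ℝ} (h : P.Dominating f) : P.Dominating (P.average f) := by
  intro x y
  have h1 := h.sub_le_conj x y
  have h2 := h.sub_le_conj y x
  rw [P.comm y x] at h2
  unfold InvariantDist.average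
  linarith

theorem conj_mono {f k : X → ℝ} (hf : P.Dominating f) (h : ∀ x, f x ≤ k x) (x : X) :
    P.conj k x ≤ P.conj f x := by
  have : Nonempty X := ⟨x⟩
  exact ciSup_le fun y => by linarith [hf.sub_le_conj x y, h y]

theorem average_le_add {f k : X → ℝ} (hf : P.Dominating f) (hk : P.Dominating k) {c : ℝ}
    (h : ∀ x, |f x - k x| ≤ c) (x : X) : |P.average f x - P.average k x| ≤ c := by
  have : Nonempty X := ⟨x⟩
  have h1 : P.conj f x ≤ P.conj k x + c := ciSup_le fun y => by
    linarith [hk.sub_le_conj x y, (abs_le.1 (h y)).1]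
  have h2 : P.conj k x ≤ P.conj f x + c := ciSup_le fun y => by
    linarith [hf.sub_le_conj x y, (abs_le.1 (h y)).2]
  have h3 := abs_le.1 (h x)
  unfold average
  rw [abs_le]
  constructor <;> linarith

variable (P) in
/-- The iterated averages. -/
def iter (f : X → ℝ) (n : ℕ) : X → ℝ := (P.average)^[n] f

theorem iter_succ (f : X → ℝ) (n : ℕ) : P.iter f (n + 1) = P.average (P.iter f n) :=
  Function.iterate_succ_apply' _ _ _

theorem Dominating.iter {f : X → ℝ} (h : P.Dominating f) (n : ℕ) : P.Dominating (P.iter f n) := by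
  induction n with
  | zero => exact h
  | succ n ih => rw [iter_succ]; exact ih.average

theorem Dominating.iter_antitone {f : X → ℝ} (h : P.Dominating f) (x : X) :
    Antitone fun n => P.iter f n x :=
  antitone_nat_of_succ_le fun n => by rw [iter_succ]; exact (h.iter n).average_le x

variable (P) in
/-- The limit of the iterated averages. -/
def retract (f : X → ℝ) (x : X) : ℝ := ⨅ n, P.iter f n x

theorem Dominating.tendsto_iter {f : X → ℝ} (h : P.Dominating f) (x : X) :
    Tendsto (fun n => P.iter f n x) atTop (𝓝 (P.retract f x)) :=
  tendsto_atTop_ciInf (h.iter_antitone x)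
    ⟨0, by rintro _ ⟨n, rfl⟩; exact (h.iter n).nonneg x⟩

theorem Dominating.retract_le {f : X → ℝ} (h : P.Dominating f) (x : X) (n : ℕ) :
    P.retract f x ≤ P.iter f n x :=
  (h.iter_antitone x).le_of_tendsto (h.tendsto_iter x) n

/-- The iterates decrease, so their conjugates increase, and each averaging at least halves the gap.
-/
theorem Dominating.iter_sub_conj_le {f : X → ℝ} (h : P.Dominating f) (x : X) (n : ℕ) :
    P.iter f n x - P.conj (P.iter f n) x ≤ (1 / 2) ^ n * (f x - P.conj f x) := by
  induction n with
  | zero => simp [InvariantDist.iter]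
  | succ n ih =>
    have h1 : P.conj (P.iter f n) x ≤ P.conj (P.iter f (n + 1)) x :=
      conj_mono (h.iter (n + 1)) (fun y => h.iter_antitone y n.le_succ) x
    have h2 : P.iter f (n + 1) x = (P.iter f n x + P.conj (P.iter f n) x) / 2 := by
      rw [iter_succ]; rfl
    rw [pow_succ]
    linarith

/-- Since the gap between iterate and conjugate tends to 0, a near-optimal `y` in the conjugate at a
late stage witnesses extremality of the limit, which lies below that iterate. -/
theorem Dominating.retract_extremal {f : X → ℝ} (h : P.Dominating f) :
    P.Dominating (P.retract f) ∧
      ∀ x, ∀ ε > 0, ∃ y, P.retract f x + P.retract f y < P.d x y + ε := by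
  refine ⟨fun x y => ?_, fun x ε hε => ?_⟩
  · exact ge_of_tendsto' ((h.tendsto_iter x).add (h.tendsto_iter y)) fun n => h.iter n x y
  · have : Nonempty X := ⟨x⟩
    have h1 : Tendsto (fun n : ℕ => (1 / 2 : ℝ) ^ n * (f x - P.conj f x)) atTop (𝓝 0) := by
      simpa using (tendsto_pow_atTop_nhds_zero_of_lt_one (by norm_num : (0 : ℝ) ≤ 1 / 2)
        (by norm_num)).mul_const (f x - P.conj f x)
    obtain ⟨n, hn⟩ := (h1.eventually_lt_const (half_pos hε)).exists
    obtain ⟨y, hy⟩ := exists_lt_of_lt_ciSup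
      (show P.conj (P.iter f n) x - ε / 2 < ⨆ y, (P.d x y - P.iter f n y) by
        show _ < P.conj (P.iter f n) x
        linarith)
    refine ⟨y, ?_⟩
    have h2 := h.iter_sub_conj_le x n
    have h3 := h.retract_le x n
    have h4 := h.retract_le y n
    linarith

theorem retract_le_add {f k : X → ℝ} (hf : P.Dominating f) (hk : P.Dominating k) {c : ℝ}
    (h : ∀ x, |f x - k x| ≤ c) (x : X) : |P.retract f x - P.retract k x| ≤ c := by
  refine le_of_tendsto' ((hf.tendsto_iter x).sub (hk.tendsto_iter x)).abs fun n => ?_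
  suffices ∀ y, |P.iter f n y - P.iter k n y| ≤ c from this x
  induction n with
  | zero => exact h
  | succ n ih => rw [iter_succ, iter_succ]; exact average_le_add (hf.iter n) (hk.iter n) ih

/-! ### Geodesics and hyperbolicity of the injective hull -/

theorem Hull.conj_eq (f : P.Hull) (x : X) : P.conj f.1 x = f.1 x := by
  refine le_antisymm (f.dominating.conj_le x) (le_of_forall_pos_lt_add fun ε hε => ?_)
  obtain ⟨y, hy⟩ := f.extremal x ε hε
  linarith [f.dominating.sub_le_conj x y]

theorem Hull.retract_eq (f : P.Hull) : P.retract f.1 = f.1 := by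
  have h1 : P.average f.1 = f.1 := funext fun x => by
    unfold average
    rw [f.conj_eq]; ring
  have h2 : ∀ n, P.iter f.1 n = f.1 := fun n => by
    induction n with
    | zero => rfl
    | succ n ih => rw [iter_succ, ih, h1]
  funext x
  unfold retract
  simp [h2]

/-- Domination is a convex condition, so the affine interpolation from `f` to `g` dominates. The
non-expansive retraction fixes its ends and yields a 1-Lipschitz path of length `dist f g`, which
must be a geodesic. -/
theorem Hull.exists_geodesic (f g : P.Hull) : ∃ γ : ℝ → P.Hull, IsGeodesic γ f g := by
  rcases eq_or_ne f g with rfl | hfg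
  · refine ⟨fun _ => f, rfl, rfl, fun s hs t ht => ?_⟩
    simp only [dist_self, Icc_self, mem_singleton_iff] at hs ht
    simp [hs, ht]
  have hD : 0 < dist f g := dist_pos.2 hfg
  set D := dist f g with hDdef
  set l : ℝ → X → ℝ := fun t x => f.1 x + t / D * (g.1 x - f.1 x) with hl
  have hdom : ∀ t ∈ Icc 0 D, P.Dominating (l t) := fun t ht x y => by
    have h1 : 0 ≤ t / D := div_nonneg ht.1 hD.le
    have h2 : t / D ≤ 1 := (div_le_one hD).2 ht.2
    have h3 := mul_le_mul_of_nonneg_left (g.dominating x y) h1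
    have h4 := mul_le_mul_of_nonneg_left (f.dominating x y) (sub_nonneg.2 h2)
    simp only [hl]
    linarith
  have hlip : ∀ s t x, |l s x - l t x| ≤ |s - t| := fun s t x => by
    have h1 : l s x - l t x = (s - t) * ((g.1 x - f.1 x) / D) := by
      simp only [hl]; field_simp; ring
    rw [h1, abs_mul, abs_div, abs_of_pos hD]
    refine mul_le_of_le_one_right (abs_nonneg _) ((div_le_one hD).2 ?_)
    rw [abs_sub_comm]
    exact abs_sub_le_dist f g x
  classical
  -- Outside `[0, D]` the interpolation need not dominate; the value `f` there is arbitrary.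
  set γ : ℝ → P.Hull := fun t =>
    if ht : t ∈ Icc 0 D then ⟨P.retract (l t), (hdom t ht).retract_extremal.1, (hdom t ht).retract_extremal.2⟩ else f with hγ
  have hγ' : ∀ t ∈ Icc 0 D, (γ t).1 = P.retract (l t) := fun t ht => by
    simp only [hγ, dif_pos ht]
  have h0 : γ 0 = f := by
    refine Hull.ext ?_
    have h2 : l 0 = f.1 := funext fun x => by simp [hl]
    rw [hγ' 0 ⟨le_rfl, hD.le⟩, h2, f.retract_eq]
  have h1 : γ D = g := by
    refine Hull.ext ?_
    have h2 : l D = g.1 := funext fun x => by simp [hl, hD.ne']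
    rw [hγ' D ⟨hD.le, le_rfl⟩, h2, g.retract_eq]
  have hle : ∀ s ∈ Icc 0 D, ∀ t ∈ Icc 0 D, dist (γ s) (γ t) ≤ |s - t| := fun s hs t ht => by
    refine dist_le (abs_nonneg _) fun x => ?_
    rw [hγ' s hs, hγ' t ht]
    exact retract_le_add (hdom s hs) (hdom t ht) (hlip s t) x
  refine ⟨γ, h0, h1, ?_⟩
  have key : ∀ s ∈ Icc 0 D, ∀ t ∈ Icc 0 D, s ≤ t → dist (γ s) (γ t) = |s - t| := by
    intro s hs t ht hst
    refine le_antisymm (hle s hs t ht) ?_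
    have h2 := hle 0 ⟨le_rfl, hD.le⟩ s hs
    have h3 := hle t ht D ⟨hD.le, le_rfl⟩
    rw [h0, zero_sub, abs_neg, abs_of_nonneg hs.1] at h2
    rw [h1, abs_sub_comm, abs_of_nonneg (sub_nonneg.2 ht.2)] at h3
    have h4 := dist_triangle4 f (γ s) (γ t) g
    rw [abs_sub_comm, abs_of_nonneg (sub_nonneg.2 hst)]
    linarith
  intro s hs t ht
  rcases le_total s t with h | h
  · exact key s hs t ht h
  · rw [dist_comm, abs_sub_comm]; exact key t ht s hs h

variable (P) in
/-- Between any two points there is a point at any prescribed distance, up to an error `1`. -/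
def IsCoarselyGeodesic : Prop :=
  ∀ x y, ∀ t ∈ Icc 0 (P.d x y), ∃ m, P.d x m ≤ t + 1 ∧ P.d m y ≤ P.d x y - t + 1

/-- If the pseudo-distance is hyperbolic and coarsely geodesic, its injective hull is close to it. -/
theorem Hull.exists_dist_of_le {κ : ℝ} (hκ : 0 ≤ κ) (h4 : FourPoint κ P.d)
    (hP : P.IsCoarselyGeodesic) [Nonempty X] (f : P.Hull) : ∃ m, dist f (of P m) ≤ κ + 2 := by
  obtain ⟨x⟩ := ‹Nonempty X›
  obtain ⟨y, hy⟩ := f.extremal x 1 one_pos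
  have fx := f.dominating.nonneg x
  have fy := f.dominating.nonneg y
  -- As `f x + f y` is nearly `d x y`, the candidate is the point at distance `f x` from `x` on a
  -- coarse geodesic to `y`.
  have hm : ∃ m, P.d x m ≤ f.1 x + 1 ∧ P.d m y ≤ f.1 y + 1 := by
    rcases le_total (f.1 x) (P.d x y) with h | h
    · obtain ⟨m, h1, h2⟩ := hP x y (f.1 x) ⟨fx, h⟩
      exact ⟨m, h1, by linarith [f.dominating x y]⟩
    · exact ⟨y, by linarith, by rw [P.self]; linarith⟩
  obtain ⟨m, hm1, hm2⟩ := hm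
  have key : ∀ p, P.d m p ≤ f.1 p + (κ + 2) := fun p => by
    have h1 := f.dominating x p
    have h2 := f.dominating y p
    have h3 := f.dominating x y
    rcases h4 x m y p with h | h
    · linarith
    · linarith
  refine ⟨m, dist_le (by linarith) fun p => ?_⟩
  rw [of_apply, abs_le]
  refine ⟨by linarith [key p], ?_⟩
  -- The upper bound on `d m` turns into an upper bound on `f` through an extremal partner `q` of
  -- `p`.
  refine le_of_forall_pos_lt_add fun ε hε => ?_
  obtain ⟨q, hq⟩ := f.extremal p ε hε
  have h1 := key q
  have h2 := P.triangle p m q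
  rw [P.comm p m] at h2
  linarith

theorem Hull.isHyperbolicSpace {κ : ℝ} (hκ : 0 ≤ κ) (h4 : FourPoint κ P.d)
    (hP : P.IsCoarselyGeodesic) [hne : Nonempty X] : IsHyperbolicSpace P.Hull where
  nonempty := hne.map (of P)
  geodesic := exists_geodesic
  hyperbolic := by
    -- Each alternative involves four distances, each altered by at most `2 * (κ + 2)`.
    refine ⟨_, FourPoint.isGromovHyp (κ := κ + 8 * (κ + 2)) fun a b c d => ?_⟩
    choose m hm using exists_dist_of_le hκ h4 hP
    have h1 : ∀ f g : P.Hull, |dist f g - P.d (m f) (m g)| ≤ 2 * (κ + 2) := fun f g => by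
      rw [← dist_of, abs_le]
      have h1 := dist_triangle4 f (of P (m f)) (of P (m g)) g
      have h2 := dist_triangle4 (of P (m f)) f g (of P (m g))
      rw [dist_comm (of P (m g)) g] at h1
      rw [dist_comm (of P (m f)) f] at h2
      constructor <;> linarith [hm f, hm g]
    have e1 := abs_le.1 (h1 a c)
    have e2 := abs_le.1 (h1 b d)
    have e3 := abs_le.1 (h1 a b)
    have e4 := abs_le.1 (h1 c d)
    have e5 := abs_le.1 (h1 b c)
    have e6 := abs_le.1 (h1 a d)
    rcases h4 (m a) (m b) (m c) (m d) with h | h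
    · left; linarith
    · right; linarith

end InvariantDist

/-! ### Chains of jumps -/

/-- `y` is reached from `x` by `n` steps of the relation `r`, inside the set `S`. -/
inductive Reach {X : Type v} (r : X → X → Prop) (S : Set X) : ℕ → X → X → Prop
  | refl {x : X} : x ∈ S → Reach r S 0 x x
  | step {n : ℕ} {x y z : X} : Reach r S n x y → r y z → z ∈ S → Reach r S (n + 1) x z

namespace Reach

variable {X : Type v} {r : X → X → Prop} {S T : Set X} {m n : ℕ} {x y z : X}

theorem left_mem (h : Reach r S n x y) : x ∈ S := by
  induction h with
  | refl h => exact h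
  | step _ _ _ ih => exact ih

theorem right_mem (h : Reach r S n x y) : y ∈ S := by
  cases h with
  | refl h => exact h
  | step _ _ h => exact h

theorem single (h : r x y) (hx : x ∈ S) (hy : y ∈ S) : Reach r S 1 x y := (refl hx).step h hy

theorem mono (h : Reach r S n x y) (hST : S ⊆ T) : Reach r T n x y := by
  induction h with
  | refl h => exact refl (hST h)
  | step _ h1 h2 ih => exact ih.step h1 (hST h2)

theorem trans (h₁ : Reach r S m x y) (h₂ : Reach r S n y z) : Reach r S (m + n) x z := by
  induction h₂ with
  | refl h => exact h₁
  | step _ h1 h2 ih => exact (ih h₁).step h1 h2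

theorem symm (hr : ∀ a b, r a b → r b a) (h : Reach r S n x y) : Reach r S n y x := by
  induction h with
  | refl h => exact refl h
  | step h0 h1 h2 ih =>
    have := (single (hr _ _ h1) h2 h0.right_mem).trans ih
    rwa [add_comm] at this

theorem split (h : Reach r S (m + n) x z) : ∃ y, Reach r S m x y ∧ Reach r S n y z := by
  induction n generalizing z with
  | zero => exact ⟨z, h, refl h.right_mem⟩
  | succ n ih =>
    cases h with
    | step h0 h1 h2 =>
      obtain ⟨y, hy1, hy2⟩ := ih h0
      exact ⟨y, hy1, hy2.step h1 h2⟩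

theorem exists_seq (h : Reach r S n x y) :
    ∃ u : ℕ → X, u 0 = x ∧ u n = y ∧ ∀ i < n, r (u i) (u (i + 1)) := by
  induction h with
  | @refl x h => exact ⟨fun _ => x, rfl, rfl, fun i hi => absurd hi (Nat.not_lt_zero i)⟩
  | @step n x y z h0 h1 h2 ih =>
    obtain ⟨u, hu0, hun, hu⟩ := ih
    refine ⟨fun i => if i ≤ n then u i else z, by simpa using hu0, by simp, fun i hi => ?_⟩
    rcases (Nat.lt_succ_iff.1 hi).lt_or_eq with h | rfl
    · have h3 : i ≤ n := h.le
      have h4 : i + 1 ≤ n := h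
      simp only [h3, h4, if_true]
      exact hu i h
    · simpa [hun] using h1

theorem map {f : X → X} (hf : ∀ a b, r a b → r (f a) (f b)) (h : Reach r univ n x y) :
    Reach r univ n (f x) (f y) := by
  induction h with
  | refl h => exact refl trivial
  | step _ h1 _ ih => exact ih.step (hf _ _ h1) trivial

end Reach

/-- The number of jumps needed to go from `x` to `y`. -/
def jumpDist {X : Type v} (r : X → X → Prop) (x y : X) : ℕ := sInf {n | Reach r univ n x y}

/-- A symmetric relation that contains all pairs at distance at most `1` and such that, whenever
`u` and `v` are related, `u` is related to all points of some geodesic from `u` to `v`. -/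
structure IsJump {X : Type v} [MetricSpace X] (r : X → X → Prop) : Prop where
  symm : ∀ u v, r u v → r v u
  near : ∀ u v, dist u v ≤ 1 → r u v
  sub : ∀ u v, r u v → ∃ γ : ℝ → X, IsGeodesic γ u v ∧ ∀ q ∈ segment γ u v, r u q

theorem jumpDist_le {X : Type v} {r : X → X → Prop} {S : Set X} {n : ℕ} {x y : X}
    (h : Reach r S n x y) : jumpDist r x y ≤ n :=
  Nat.sInf_le (h.mono (subset_univ S))

theorem jumpDist_self {X : Type v} {r : X → X → Prop} (x : X) : jumpDist r x x = 0 :=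
  Nat.le_zero.1 (jumpDist_le (.refl (mem_univ x)))

theorem jumpDist_le_one {X : Type v} {r : X → X → Prop} {x y : X} (h : r x y) :
    jumpDist r x y ≤ 1 :=
  jumpDist_le (.single h (mem_univ x) (mem_univ y))

/-! ### Hyperbolicity of the jump distance -/

namespace IsJump

variable {X : Type v} [MetricSpace X] [IsHyperbolicSpace X] {r : X → X → Prop}

theorem exists_reach (hr : IsJump r) (x y : X) :
    ∃ n : ℕ, Reach r univ n x y ∧ (n : ℝ) ≤ dist x y + 1 := by
  obtain ⟨γ, hγ⟩ := IsHyperbolicSpace.geodesic x y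
  refine ⟨⌈dist x y⌉₊, ?_, (Nat.ceil_lt_add_one dist_nonneg).le⟩
  have key : ∀ n : ℕ, Reach r univ n x (γ (min n (dist x y))) := fun n => by
    induction n with
    | zero =>
      rw [Nat.cast_zero, min_eq_left dist_nonneg, hγ.1]
      exact .refl trivial
    | succ n ih =>
      refine ih.step (hr.near _ _ ?_) trivial
      rw [hγ.2.2 _ ⟨le_min n.cast_nonneg dist_nonneg, min_le_right _ _⟩ _
        ⟨le_min (n + 1).cast_nonneg dist_nonneg, min_le_right _ _⟩]
      refine (abs_min_sub_min_le_max _ _ _ _).trans ?_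
      simp
  have := key ⌈dist x y⌉₊
  rwa [min_eq_right (Nat.le_ceil _), hγ.2.1] at this

/-- Unit steps along a geodesic give some chain, so the `sInf` is attained and is not the default 0
of an empty set. -/
theorem reach (hr : IsJump r) (x y : X) : Reach r univ (jumpDist r x y) x y :=
  Nat.sInf_mem (s := {n | Reach r univ n x y}) ((hr.exists_reach x y).imp fun _ h => h.1)

theorem jumpDist_le_dist (hr : IsJump r) (x y : X) : (jumpDist r x y : ℝ) ≤ dist x y + 1 := by
  obtain ⟨n, h1, h2⟩ := hr.exists_reach x y
  exact (Nat.cast_le.2 (jumpDist_le h1)).trans h2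


theorem jumpDist_triangle (hr : IsJump r) (x y z : X) :
    jumpDist r x z ≤ jumpDist r x y + jumpDist r y z :=
  jumpDist_le ((hr.reach x y).trans (hr.reach y z))

theorem jumpDist_comm (hr : IsJump r) (x y : X) : jumpDist r x y = jumpDist r y x :=
  le_antisymm (jumpDist_le ((hr.reach y x).symm hr.symm))
    (jumpDist_le ((hr.reach x y).symm hr.symm))

/-- A chain of `n` jumps passes at distance `O(log n)` from each geodesic joining its ends. -/
theorem exists_near_of_reach (hr : IsJump r) {κ : ℝ} (hκ : 0 ≤ κ)
    (hX : FourPoint κ (dist : X → X → ℝ)) {S : Set X} (k : ℕ) :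
    ∀ {n : ℕ} {x y : X}, Reach r S n x y → n ≤ 2 ^ k → ∀ {γ : ℝ → X}, IsGeodesic γ x y →
      ∀ p ∈ segment γ x y, ∃ u ∈ S, ∃ q, r u q ∧ dist p q ≤ k * (2 * κ) + κ := by
  induction k with
  | zero =>
    intro n x y h hn γ hγ p hp
    have h1 := hγ.dist_add hp
    have hxS := h.left_mem
    cases h with
    | refl h =>
      refine ⟨x, h, x, hr.near x x (by simp), ?_⟩
      rw [dist_self, dist_comm p x] at h1
      rw [dist_comm]
      simp only [Nat.cast_zero]
      linarith
    | @step n _ y _ h2 h3 h4 =>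
      have hn0 : n = 0 := by simpa using hn
      subst hn0
      cases h2
      obtain ⟨γ', h5, h6⟩ := hr.sub _ _ h3
      obtain ⟨q, hq, hpq⟩ := h5.exists_near hX (m := p) (c := 0) (by linarith) hκ
      exact ⟨x, hxS, q, h6 q hq, by simpa using hpq⟩
  | succ k ih =>
    intro n x y h hn γ hγ p hp
    -- The chain is cut in half at `m`. By thinness `p` is coarsely on `[x, m]` or `[m, y]`, and
    -- moving it onto that side costs `2κ`.
    obtain ⟨a, b, rfl, ha, hb⟩ : ∃ a b, n = a + b ∧ a ≤ 2 ^ k ∧ b ≤ 2 ^ k :=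
      ⟨min n (2 ^ k), n - min n (2 ^ k), by omega, by omega, by rw [pow_succ] at hn; omega⟩
    obtain ⟨m, h1, h2⟩ := h.split
    have key : ∀ {a : ℕ} {x y : X}, Reach r S a x y → a ≤ 2 ^ k →
        dist x p + dist p y ≤ dist x y + κ →
        ∃ u ∈ S, ∃ q, r u q ∧ dist p q ≤ ((k + 1 : ℕ) : ℝ) * (2 * κ) + κ := by
      intro a x y h ha hxy
      obtain ⟨γ', hγ'⟩ := IsHyperbolicSpace.geodesic x y
      obtain ⟨p', hp', hpp⟩ := hγ'.exists_near hX hxy hκ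
      obtain ⟨u, hu, q, huq, hq⟩ := ih h ha hγ' p' hp'
      refine ⟨u, hu, q, huq, (dist_triangle p p' q).trans ?_⟩
      push_cast
      linarith
    rcases hγ.thin hX hp m with h3 | h3
    · exact key h1 ha h3
    · exact key h2 hb h3

/-- Any two points are joined by a set in which the jump distance is realized. -/
theorem exists_chain (hr : IsJump r) (x y : X) : ∃ C : Set X, x ∈ C ∧ y ∈ C ∧
    (∀ a ∈ C, ∀ b ∈ C, Reach r C (jumpDist r a b) a b) ∧
    ∀ a ∈ C, jumpDist r x a + jumpDist r a y = jumpDist r x y := by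
  obtain ⟨u, hu0, hun, hu⟩ := (hr.reach x y).exists_seq
  set n := jumpDist r x y with hn
  set C := u '' Iic n with hC
  have hmem : ∀ i ≤ n, u i ∈ C := fun i hi => ⟨i, hi, rfl⟩
  have h1 : ∀ i j, i + j ≤ n → Reach r C j (u i) (u (i + j)) := fun i j => by
    induction j with
    | zero => exact fun h => .refl (hmem i h)
    | succ j ih => exact fun h => (ih (by omega)).step (hu _ (by omega)) (hmem _ h)
  -- A shorter way between two points of the chain would shorten the whole chain, which is minimal.
  have h2 : ∀ i j, i + j ≤ n → jumpDist r (u i) (u (i + j)) = j := fun i j hij => by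
    refine le_antisymm (jumpDist_le (h1 i j hij)) ?_
    have e1 := jumpDist_le (h1 0 i (by omega))
    have e2 := jumpDist_le (h1 (i + j) (n - (i + j)) (by omega))
    rw [zero_add, hu0] at e1
    rw [show i + j + (n - (i + j)) = n by omega, hun] at e2
    have e3 := hr.jumpDist_triangle x (u i) y
    have e4 := hr.jumpDist_triangle (u i) (u (i + j)) y
    omega
  refine ⟨C, ⟨0, Nat.zero_le n, hu0⟩, ⟨n, mem_Iic.2 le_rfl, hun⟩, ?_, ?_⟩
  · rintro _ ⟨i, hi, rfl⟩ _ ⟨j, hj, rfl⟩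
    simp only [mem_Iic] at hi hj
    rcases le_total i j with h | h
    · obtain ⟨l, rfl⟩ := Nat.exists_eq_add_of_le h
      rw [h2 i l hj]
      exact h1 i l hj
    · obtain ⟨l, rfl⟩ := Nat.exists_eq_add_of_le h
      rw [hr.jumpDist_comm, h2 j l hi]
      exact (h1 j l hi).symm hr.symm
  · rintro _ ⟨i, hi, rfl⟩
    simp only [mem_Iic] at hi
    have e1 := h2 0 i (by omega)
    have e2 := h2 i (n - i) (by omega)
    rw [zero_add, hu0] at e1
    rw [show i + (n - i) = n by omega, hun] at e2
    omega

/-- A walk that starts at distance at least `D` from a set `C` and ends in it reaches a point from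
which `C` is accessible without coming close to the starting point. -/
theorem exists_detour (hr : IsJump r) {C : Set X} {m : X} {D : ℕ}
    (hC : ∀ c ∈ C, D ≤ jumpDist r m c) (σ : ℕ → X) (h0 : σ 0 = m)
    (hσ : ∀ k, jumpDist r (σ k) (σ (k + 1)) ≤ 1) (hD : ∀ k, ∃ c ∈ C, jumpDist r (σ k) c ≤ D)
    (hend : ∃ k, σ k ∈ C) :
    ∃ k, ∃ a ∈ C, ∃ l ≤ D, Reach r {v | D ≤ jumpDist r m v} l (σ k) a ∧
      jumpDist r m a ≤ 3 * D := by
  classical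
  -- The walk stops when it first meets `C` or gets `2D` away from `m`. In the second case a further
  -- chain of at most `D` jumps leads to `C` and stays at least `2D - D` away from `m`.
  have hex : ∃ k, 2 * D ≤ jumpDist r m (σ k) ∨ σ k ∈ C := hend.imp fun _ h => Or.inr h
  have hspec := Nat.find_spec hex
  have hmin := fun j => Nat.find_min hex (m := j)
  set k := Nat.find hex
  have hle : jumpDist r m (σ k) ≤ 2 * D := by
    rcases Nat.eq_zero_or_pos k with hk | hk
    · rw [hk, h0, jumpDist_self]; exact Nat.zero_le _
    · have h1 := hmin (k - 1) (by omega)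
      have h2 := hσ (k - 1)
      rw [Nat.sub_add_cancel hk] at h2
      have h3 := hr.jumpDist_triangle m (σ (k - 1)) (σ k)
      rw [not_or] at h1
      omega
  rcases hspec with h | h
  · obtain ⟨c, hc, hcD⟩ := hD k
    refine ⟨k, c, hc, jumpDist r (σ k) c, hcD, ?_, ?_⟩
    · obtain ⟨B, hB1, hB2, hB, hB'⟩ := hr.exists_chain (σ k) c
      refine (hB _ hB1 _ hB2).mono fun v hv => ?_
      have h2 := hB' v hv
      have h3 := hr.jumpDist_triangle m v (σ k)
      have h4 := hr.jumpDist_comm v (σ k)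
      show D ≤ jumpDist r m v
      omega
    · have := hr.jumpDist_triangle m (σ k) c
      omega
  · exact ⟨k, σ k, h, 0, Nat.zero_le D, .refl (hC _ h), by omega⟩

/-- For the least `k` with `8 * D ≤ 2 ^ k`, the power `2 ^ (k - 1)` is below `8 * D`, which is at
most linear in `k`; this bounds `k`, hence `D`. -/
theorem exists_log_bound (κ : ℝ) (hκ : 0 ≤ κ) : ∃ D₀ : ℝ, ∀ D : ℕ,
    (∀ k : ℕ, 8 * D ≤ 2 ^ k → (D : ℝ) ≤ k * (2 * κ) + κ + 2) → (D : ℝ) ≤ D₀ := by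
  have h1 : ∀ᶠ k : ℕ in atTop, 8 * (((k : ℝ) + 1) * (2 * κ) + κ + 2) < 2 ^ k := by
    have h2 := tendsto_pow_const_div_const_pow_of_one_lt 1 (one_lt_two (α := ℝ))
    have hA : 0 < 40 * κ + 17 := by positivity
    filter_upwards [h2.eventually_lt_const (inv_pos.2 hA), eventually_ge_atTop 1] with k hk hk1
    rw [pow_one, div_lt_iff₀ (by positivity), inv_mul_eq_div, lt_div_iff₀ hA] at hk
    have hk1' : (1 : ℝ) ≤ k := by exact_mod_cast hk1
    nlinarith [mul_le_mul_of_nonneg_right hk1' hκ]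
  obtain ⟨k₀, hk₀⟩ := eventually_atTop.1 h1
  refine ⟨k₀ * (2 * κ) + κ + 2, fun D hD => ?_⟩
  by_cases h : 8 * D ≤ 2 ^ k₀
  · exact hD k₀ h
  · exfalso
    have hex : ∃ k, 8 * D ≤ 2 ^ k := ⟨8 * D, Nat.lt_two_pow_self.le⟩
    classical
    have hs := Nat.find_spec hex
    have hm := fun j => Nat.find_min hex (m := j)
    set k := Nat.find hex
    have hk : k₀ < k := by
      by_contra hk
      exact h (hs.trans (Nat.pow_le_pow_right (by norm_num) (not_lt.1 hk)))
    obtain ⟨j, hj⟩ : ∃ j, k = j + 1 := ⟨k - 1, by omega⟩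
    have h2 := hm j (by omega)
    have h3 := hD k hs
    have h4 := hk₀ j (by omega)
    rw [not_le] at h2
    have h5 : ((2 : ℝ)) ^ j < 8 * D := by exact_mod_cast h2
    rw [hj] at h3
    push_cast at h3
    linarith

/-- Geodesics are coarsely geodesic for the jump distance. -/
theorem exists_jumpDist_add_le (hr : IsJump r) : ∃ C : ℝ, 0 ≤ C ∧ ∀ (x y : X) (γ : ℝ → X),
    IsGeodesic γ x y → ∀ p ∈ segment γ x y,
      (jumpDist r x p + jumpDist r p y : ℝ) ≤ jumpDist r x y + C := by
  obtain ⟨δ, hδ, hX⟩ := exists_isGromovHyp X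
  replace hX := hX.fourPoint
  have hκ : 0 ≤ 2 * δ := by linarith
  set κ := 2 * δ
  obtain ⟨D₀, hD₀⟩ := exists_log_bound κ hκ
  refine ⟨2 * max D₀ 0, by positivity, fun x y γ hγ p hp => ?_⟩
  obtain ⟨C, hxC, hyC, hC, hC'⟩ := hr.exists_chain x y
  -- `D` is the maximal depth of a point of the geodesic relative to `C`, attained at `m`. It exists
  -- because depths are at most `dist x y + 1`.
  obtain ⟨D, ⟨m, hm, hmD⟩, hD⟩ : ∃ D : ℕ, (∃ m ∈ segment γ x y, ∀ c ∈ C, D ≤ jumpDist r m c) ∧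
      ¬ ∃ m ∈ segment γ x y, ∀ c ∈ C, D + 1 ≤ jumpDist r m c := by
    by_contra! hcon
    have hall : ∀ D : ℕ, ∃ m ∈ segment γ x y, ∀ c ∈ C, D ≤ jumpDist r m c := fun D => by
      induction D with
      | zero => exact ⟨x, hγ.left_mem, fun c _ => Nat.zero_le _⟩
      | succ D ih => exact hcon D ih
    obtain ⟨D, hD⟩ := exists_nat_gt (dist x y + 1)
    obtain ⟨m, hm, hmD⟩ := hall D
    have h1 := hr.jumpDist_le_dist m x
    have h2 : (D : ℝ) ≤ jumpDist r m x := by exact_mod_cast hmD x hxC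
    have h3 := hγ.dist_add hm
    rw [dist_comm x m] at h3
    linarith [dist_nonneg (x := m) (y := y)]
  push Not at hD
  replace hD : ∀ m ∈ segment γ x y, ∃ c ∈ C, jumpDist r m c ≤ D := fun m hm => by
    obtain ⟨c, hc, h⟩ := hD m hm
    exact ⟨c, hc, by omega⟩
  have hDle : (D : ℝ) ≤ D₀ := by
    refine hD₀ D fun k hk => ?_
    obtain ⟨t, ht, rfl⟩ := hm
    have hstep : ∀ s ∈ Icc 0 (dist x y), ∀ s' ∈ Icc 0 (dist x y), |s - s'| ≤ 1 →
        jumpDist r (γ s) (γ s') ≤ 1 := fun s hs s' hs' h =>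
      jumpDist_le_one (hr.near _ _ ((hγ.2.2 s hs s' hs').trans_le h))
    have hl : ∀ i : ℕ, max (t - i) 0 ∈ Icc 0 t := fun i =>
      ⟨le_max_right _ _, max_le (by linarith [i.cast_nonneg (α := ℝ)]) ht.1⟩
    have hl' : ∀ i : ℕ, max (t - i) 0 ∈ Icc 0 (dist x y) := fun i =>
      ⟨(hl i).1, (hl i).2.trans ht.2⟩
    have hu : ∀ i : ℕ, min (t + i) (dist x y) ∈ Icc t (dist x y) := fun i =>
      ⟨le_min (by linarith [i.cast_nonneg (α := ℝ)]) ht.2, min_le_right _ _⟩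
    have hu' : ∀ i : ℕ, min (t + i) (dist x y) ∈ Icc 0 (dist x y) := fun i =>
      ⟨ht.1.trans (hu i).1, (hu i).2⟩
    -- From `m`, walk in unit steps along the geodesic towards `x`, and below towards `y`, leaving
    -- to points `a` and `b` of `C`.
    obtain ⟨i, a, ha, l₁, hl₁, hR₁, hma⟩ := hr.exists_detour hmD
      (fun i => γ (max (t - i) 0)) (by simp [ht.1])
      (fun i => hstep _ (hl' i) _ (hl' (i + 1)) (by
        refine (abs_max_sub_max_le_max _ _ _ _).trans ?_
        push_cast; simp))
      (fun i => hD _ ⟨_, hl' i, rfl⟩)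
      (by
        obtain ⟨i, hi⟩ := exists_nat_ge t
        refine ⟨i, ?_⟩
        rw [max_eq_right (by linarith), hγ.1]
        exact hxC)
    obtain ⟨j, b, hb, l₂, hl₂, hR₂, hmb⟩ := hr.exists_detour hmD
      (fun i => γ (min (t + i) (dist x y))) (by simp [ht.2])
      (fun i => hstep _ (hu' i) _ (hu' (i + 1)) (by
        refine (abs_min_sub_min_le_max _ _ _ _).trans ?_
        push_cast; simp))
      (fun i => hD _ ⟨_, hu' i, rfl⟩)
      (by
        obtain ⟨i, hi⟩ := exists_nat_ge (dist x y)
        refine ⟨i, ?_⟩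
        rw [min_eq_right (by linarith [ht.1]), hγ.2.1]
        exact hyC)
    have hab : jumpDist r a b ≤ 6 * D := by
      have := hr.jumpDist_triangle a (γ t) b
      have := hr.jumpDist_comm a (γ t)
      omega
    -- The bypass has at most `D + 6D + D` jumps and its vertices stay at jump distance at least `D`
    -- from `m`.
    have hR := (hR₁.trans ((hC a ha b hb).mono hmD)).trans (hR₂.symm hr.symm)
    obtain ⟨hd, hgeo⟩ := hγ.sub (hl i).1 ((hl i).2.trans (hu j).1) (hu j).2
    obtain ⟨v, hv, q, hvq, hq⟩ := hr.exists_near_of_reach hκ hX k hR (by omega) hgeo (γ t)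
      ⟨t - max (t - i) 0, by
        rw [hd]; exact ⟨by linarith [(hl i).2], by linarith [(hu j).1]⟩, by simp⟩
    -- Rounding a distance to jumps costs 1 and the jump from `q` to `v` costs 1, whence the `+ 2`
    -- in the bound for `D`.
    have e1 := hr.jumpDist_le_dist (γ t) q
    have e2 : (jumpDist r (γ t) v : ℝ) ≤ jumpDist r (γ t) q + 1 := by
      have h1 := hr.jumpDist_triangle (γ t) q v
      have h2 := jumpDist_le_one (hr.symm _ _ hvq)
      exact_mod_cast h1.trans (by omega)
    have e3 : (D : ℝ) ≤ jumpDist r (γ t) v := by exact_mod_cast hv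
    linarith
  obtain ⟨c, hc, hpc⟩ := hD p hp
  have e1 : (jumpDist r x p + jumpDist r p y : ℝ) ≤ jumpDist r x y + 2 * D := by
    have h1 := hr.jumpDist_triangle x c p
    have h2 := hr.jumpDist_triangle p c y
    have h3 := hr.jumpDist_comm c p
    have h4 := hC' c hc
    exact_mod_cast (by omega : jumpDist r x p + jumpDist r p y ≤ jumpDist r x y + 2 * D)
  linarith [le_max_left D₀ 0]

/-- A point coarsely between `x` and `y` is coarsely between them for the jump distance. -/
theorem exists_jumpDist_add_le_of_dist (hr : IsJump r) (c : ℝ) : ∃ C : ℝ, 0 ≤ C ∧ ∀ x p y : X,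
    dist x p + dist p y ≤ dist x y + c →
      (jumpDist r x p + jumpDist r p y : ℝ) ≤ jumpDist r x y + C := by
  obtain ⟨δ, hδ, hX⟩ := exists_isGromovHyp X
  replace hX := hX.fourPoint
  obtain ⟨C, hC0, hC⟩ := hr.exists_jumpDist_add_le
  refine ⟨C + 2 * (|c| + 2 * δ + 1), by positivity, fun x p y h => ?_⟩
  obtain ⟨γ, hγ⟩ := IsHyperbolicSpace.geodesic x y
  obtain ⟨q, hq, hpq⟩ := hγ.exists_near hX h (by linarith)
  have h1 := hC x y γ hγ q hq
  have h2 := hr.jumpDist_le_dist p q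
  have h3 : (jumpDist r x p : ℝ) ≤ jumpDist r x q + jumpDist r p q := by
    rw [hr.jumpDist_comm p q]; exact_mod_cast hr.jumpDist_triangle x q p
  have h4 : (jumpDist r p y : ℝ) ≤ jumpDist r p q + jumpDist r q y := by
    exact_mod_cast hr.jumpDist_triangle p q y
  linarith [le_abs_self c]

/-- The jump distance is hyperbolic. -/
theorem exists_fourPoint (hr : IsJump r) :
    ∃ κ : ℝ, 0 ≤ κ ∧ FourPoint κ fun x y => (jumpDist r x y : ℝ) := by
  obtain ⟨δ, hδ, hG⟩ := exists_isGromovHyp X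
  have hX := hG.fourPoint
  obtain ⟨C, hC0, hC⟩ := hr.exists_jumpDist_add_le_of_dist (2 * δ)
  have tri : ∀ x p y, (jumpDist r x y : ℝ) ≤ jumpDist r x p + jumpDist r p y := fun x p y => by
    exact_mod_cast hr.jumpDist_triangle x p y
  refine ⟨2 * C, by positivity, fun x y z w => ?_⟩
  -- If `w` projects to `[x, z]` before `y` does, the projection of `y` is coarsely between `x` and
  -- `y` as well as between `z` and `w`. Routing `x` to `z` and `y` to `w` through it gives the
  -- estimate.
  have key : ∀ y w : X, gromovProd x w z ≤ gromovProd x y z →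
      (jumpDist r x z + jumpDist r y w : ℝ) ≤ jumpDist r x y + jumpDist r z w + 2 * C := by
    intro y w hyw
    obtain ⟨γ, hγ⟩ := IsHyperbolicSpace.geodesic x z
    set t := gromovProd x y z with ht
    have htI : t ∈ Icc 0 (dist x z) := by
      have h1 := dist_triangle y x z
      have h2 := dist_triangle x y z
      have h3 := dist_triangle y z x
      rw [ht]; unfold gromovProd
      rw [dist_comm z x, dist_comm y x] at *
      constructor <;> linarith
    have hy1 := hγ.dist_le_or hX htI y
    have hw1 := hγ.dist_le_or hX htI w
    have hl := hγ.dist_left htI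
    have hrt := hγ.dist_right htI
    have e1 : dist x (γ t) + dist (γ t) y ≤ dist x y + 2 * δ := by
      rw [dist_comm (γ t) y]
      unfold gromovProd at ht
      rw [dist_comm z x, dist_comm y x] at ht
      rcases hy1 with h | h <;> linarith
    have e2 : dist z (γ t) + dist (γ t) w ≤ dist z w + 2 * δ := by
      rw [dist_comm (γ t) w, dist_comm z (γ t), dist_comm z w]
      unfold gromovProd at hyw
      rw [dist_comm z x, dist_comm w x] at hyw
      rcases hw1 with h | h <;> linarith
    have f1 := hC _ _ _ e1
    have f2 := hC _ _ _ e2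
    have f3 := tri x (γ t) z
    have f4 := tri y (γ t) w
    rw [hr.jumpDist_comm y (γ t)] at f4
    rw [hr.jumpDist_comm z (γ t)] at f2
    linarith
  rcases le_total (gromovProd x w z) (gromovProd x y z) with h | h
  · exact Or.inl (key y w h)
  · right
    have := key w y h
    simp only [hr.jumpDist_comm w y, hr.jumpDist_comm z y] at this
    linarith

end IsJump

/-! ### Coning off what is far from an orbit -/

theorem gromovProd_mem_Icc {X : Type v} [MetricSpace X] (z u z' : X) : gromovProd z u z' ∈ Icc 0 (dist z z') := by
  have h1 := dist_triangle u z z'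
  have h2 := dist_triangle u z' z
  have h3 := dist_triangle z u z'
  unfold gromovProd
  rw [dist_comm z u] at h3
  rw [dist_comm z' z] at *
  constructor <;> linarith

section

variable (G : Type u) [Group G] {X : Type v} [MetricSpace X] [MulAction G X]

/-- Two points are related if they are at distance at most `1`, or joined by a geodesic that stays
at distance more than `R` from the orbit of `o`. -/
def OrbitJump (o : X) (R : ℝ) (x y : X) : Prop :=
  dist x y ≤ 1 ∨ ∃ γ : ℝ → X, IsGeodesic γ x y ∧ ∀ p ∈ segment γ x y, ∀ g : G, R < dist p (g • o)

variable {G}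

theorem IsGeodesic.initial {γ : ℝ → X} {x y : X} (h : IsGeodesic γ x y) {t : ℝ}
    (ht : t ∈ Icc 0 (dist x y)) :
    IsGeodesic γ x (γ t) ∧ segment γ x (γ t) ⊆ segment γ x y := by
  have hd := h.dist_left ht
  refine ⟨⟨h.1, by rw [hd], fun a ha b hb => ?_⟩, ?_⟩
  · rw [hd] at ha hb
    exact h.2.2 a ⟨ha.1, ha.2.trans ht.2⟩ b ⟨hb.1, hb.2.trans ht.2⟩
  · rintro _ ⟨s, hs, rfl⟩
    rw [hd] at hs
    exact ⟨s, ⟨hs.1, hs.2.trans ht.2⟩, rfl⟩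

theorem isJump_orbitJump [IsHyperbolicSpace X] (o : X) (R : ℝ) : IsJump (OrbitJump G o R) where
  symm x y h := by
    rcases h with h | ⟨γ, h1, h2⟩
    · exact Or.inl (by rwa [dist_comm])
    · exact Or.inr ⟨_, h1.symm, by rwa [segment_symm]⟩
  near x y h := Or.inl h
  sub x y h := by
    rcases h with h | ⟨γ, h1, h2⟩
    · obtain ⟨γ, hγ⟩ := IsHyperbolicSpace.geodesic x y
      refine ⟨γ, hγ, fun q hq => Or.inl ?_⟩
      linarith [hγ.dist_add hq, dist_nonneg (x := q) (y := y)]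
    · refine ⟨γ, h1, ?_⟩
      rintro _ ⟨t, ht, rfl⟩
      exact Or.inr ⟨γ, (h1.initial ht).1, fun p hp => h2 p ((h1.initial ht).2 hp)⟩

/-- If `[z, z']` stays close to the orbit, its coordinate changes little under a jump. -/
theorem OrbitJump.gromovProd_sub_le {κ : ℝ} (hκ : 0 ≤ κ) (hX : FourPoint κ (dist : X → X → ℝ))
    {o z z' : X} {Q : ℝ} {γ : ℝ → X} (hγ : IsGeodesic γ z z')
    (hQ : ∀ p ∈ segment γ z z', ∃ g : G, dist p (g • o) ≤ Q) {u v : X}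
    (h : OrbitJump G o (Q + 4 * κ) u v) :
    gromovProd z v z' - gromovProd z u z' ≤ κ + 1 := by
  rcases h with h | ⟨γ', h1, h2⟩
  · have h1 := dist_triangle v u z
    have h2 := dist_triangle u v z'
    rw [dist_comm v u] at h1
    unfold gromovProd
    linarith
  -- Otherwise the projection of `u` to `[z, z']` is coarsely between `u` and `v`, with error `3κ`,
  -- hence within `4κ` of the geodesic of the jump. Being within `Q` of the orbit, it contradicts
  -- the radius `Q + 4κ`.
  · by_contra! hlt
    have ht := gromovProd_mem_Icc z u z'
    have hu := hγ.dist_le_or hX ht u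
    have hv := hγ.dist_le_or hX ht v
    have h4 := hX u v z' z
    have hm : dist u (γ (gromovProd z u z')) + dist (γ (gromovProd z u z')) v ≤
        dist u v + 3 * κ := by
      rw [dist_comm _ v]
      set m := γ (gromovProd z u z')
      unfold gromovProd at hu hv hlt
      rw [dist_comm z' z, dist_comm u z, dist_comm v z] at *
      rcases h4 with h4 | h4 <;> rcases hu with hu | hu <;> rcases hv with hv | hv <;> linarith
    obtain ⟨p, hp, hmp⟩ := h1.exists_near hX hm hκ
    obtain ⟨g, hg⟩ := hQ _ ⟨_, ht, rfl⟩
    have h5 := h2 p hp g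
    have h6 := dist_triangle p (γ (gromovProd z u z')) (g • o)
    rw [dist_comm p (γ (gromovProd z u z'))] at h6
    linarith

variable [IsIsometricSMul G X]

theorem OrbitJump.smul {o : X} {R : ℝ} {x y : X} (h : OrbitJump G o R x y) (g : G) :
    OrbitJump G o R (g • x) (g • y) := by
  rcases h with h | ⟨γ, h1, h2⟩
  · exact Or.inl (by rwa [dist_smul])
  · refine Or.inr ⟨fun t => g • γ t, ⟨congrArg (g • ·) h1.1, by
      rw [dist_smul]; exact congrArg (g • ·) h1.2.1, ?_⟩, ?_⟩
    · intro s hs t ht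
      rw [dist_smul] at *
      exact h1.2.2 s hs t ht
    · rintro _ ⟨t, ht, rfl⟩ k
      rw [dist_smul] at ht
      have := h2 _ ⟨t, ht, rfl⟩ (g⁻¹ * k)
      rwa [← dist_smul g, smul_smul, mul_inv_cancel_left] at this

variable [IsHyperbolicSpace X]

variable (G) in
/-- The jump distance of the relation `OrbitJump`. -/
def orbitDist (o : X) (R : ℝ) : InvariantDist G X where
  d x y := jumpDist (OrbitJump G o R) x y
  self x := by rw [jumpDist_self, Nat.cast_zero]
  comm x y := by rw [(isJump_orbitJump o R).jumpDist_comm]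
  triangle x y z := by exact_mod_cast (isJump_orbitJump o R).jumpDist_triangle x y z
  smul := by
    have key : ∀ (g : G) (x y : X), jumpDist (OrbitJump G o R) (g • x) (g • y) ≤
        jumpDist (OrbitJump G o R) x y := fun g x y =>
      jumpDist_le (((isJump_orbitJump o R).reach x y).map (f := (g • ·)) fun _ _ h => h.smul g)
    intro g x y
    refine congrArg Nat.cast (le_antisymm (key g x y) ?_)
    simpa using key g⁻¹ (g • x) (g • y)

theorem orbitDist_isCoarselyGeodesic (o : X) (R : ℝ) :
    (orbitDist G o R).IsCoarselyGeodesic := by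
  intro x y t ht
  have h1 := (isJump_orbitJump (G := G) o R).reach x y
  set n := jumpDist (OrbitJump G o R) x y with hn
  have ht2 : t ≤ n := ht.2
  have hf : ⌊t⌋₊ ≤ n := Nat.floor_le_of_le ht2
  rw [← Nat.add_sub_cancel' hf] at h1
  obtain ⟨m, h2, h3⟩ := h1.split
  have h4 : (jumpDist (OrbitJump G o R) x m : ℝ) ≤ ⌊t⌋₊ := by exact_mod_cast jumpDist_le h2
  have h5 : (jumpDist (OrbitJump G o R) m y : ℝ) ≤ n - ⌊t⌋₊ := by
    rw [← Nat.cast_sub hf]; exact_mod_cast jumpDist_le h3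
  refine ⟨m, ?_, ?_⟩
  · show (jumpDist (OrbitJump G o R) x m : ℝ) ≤ t + 1
    linarith [Nat.floor_le ht.1]
  · show (jumpDist (OrbitJump G o R) m y : ℝ) ≤ n - t + 1
    linarith [Nat.lt_floor_add_one t]

/-- Every point is at bounded jump distance from the orbit. -/
theorem exists_orbitDist_le (o : X) {R : ℝ} (hR : 0 ≤ R) (x : X) :
    ∃ g : G, (orbitDist G o R).d x (g • o) ≤ R + 4 := by
  have hJ := isJump_orbitJump (G := G) o R
  have hbdd : BddBelow (range fun g : G => dist x (g • o)) :=
    ⟨0, by rintro _ ⟨g, rfl⟩; exact dist_nonneg⟩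
  set ρ := ⨅ g : G, dist x (g • o) with hρ
  obtain ⟨g, hg⟩ := exists_lt_of_ciInf_lt (show (⨅ g : G, dist x (g • o)) < ρ + 1 by linarith)
  have hρle : ∀ k : G, ρ ≤ dist x (k • o) := fun k => ciInf_le hbdd k
  refine ⟨g, ?_⟩
  show (jumpDist (OrbitJump G o R) x (g • o) : ℝ) ≤ R + 4
  rcases le_total ρ (R + 1) with h | h
  · have := hJ.jumpDist_le_dist x (g • o)
    linarith
  -- Along an almost shortest geodesic to the orbit, the part up to `ρ - (R + 1)` is at least `R +
  -- 1` away from the orbit and is crossed by one jump. The rest has length at most `R + 2`.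
  · obtain ⟨γ, hγ⟩ := IsHyperbolicSpace.geodesic x (g • o)
    have ht : ρ - (R + 1) ∈ Icc 0 (dist x (g • o)) := ⟨by linarith, by linarith [hρle g]⟩
    have h1 : OrbitJump G o R x (γ (ρ - (R + 1))) := by
      refine Or.inr ⟨γ, (hγ.initial ht).1, ?_⟩
      rintro _ ⟨s, hs, rfl⟩ k
      rw [hγ.dist_left ht] at hs
      have h2 := hγ.dist_left (t := s) ⟨hs.1, hs.2.trans ht.2⟩
      have h3 := dist_triangle x (γ s) (k • o)
      linarith [hρle k, hs.2]
    have h2 : (jumpDist (OrbitJump G o R) x (γ (ρ - (R + 1))) : ℝ) ≤ 1 := by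
      exact_mod_cast jumpDist_le_one h1
    have h3 := hJ.jumpDist_le_dist (γ (ρ - (R + 1))) (g • o)
    rw [hγ.dist_right ht] at h3
    have h4 : (jumpDist (OrbitJump G o R) x (g • o) : ℝ) ≤
        jumpDist (OrbitJump G o R) x (γ (ρ - (R + 1))) +
          jumpDist (OrbitJump G o R) (γ (ρ - (R + 1))) (g • o) := by
      exact_mod_cast hJ.jumpDist_triangle _ _ _
    linarith

/-- The coordinate `gromovProd z · z'` goes from 0 at `z` to `dist z z'` at `z'`, and each jump
advances it by at most `κ + 1`. -/
theorem dist_le_orbitDist {κ : ℝ} (hκ : 0 ≤ κ) (hX : FourPoint κ (dist : X → X → ℝ))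
    {o z z' : X} {Q : ℝ} {γ : ℝ → X} (hγ : IsGeodesic γ z z')
    (hQ : ∀ p ∈ segment γ z z', ∃ g : G, dist p (g • o) ≤ Q) :
    dist z z' ≤ (κ + 1) * (orbitDist G o (Q + 4 * κ)).d z z' := by
  have key : ∀ {n : ℕ} {u v : X}, Reach (OrbitJump G o (Q + 4 * κ)) univ n u v →
      gromovProd z v z' - gromovProd z u z' ≤ (κ + 1) * n := by
    intro n u v h
    induction h with
    | refl => simp
    | step h0 h1 _ ih =>
      have := h1.gromovProd_sub_le hκ hX hγ hQ
      push_cast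
      linarith
  have := key ((isJump_orbitJump (G := G) o (Q + 4 * κ)).reach z z')
  have h1 : gromovProd z z' z' = dist z z' := by
    unfold gromovProd; rw [dist_self, dist_comm z' z]; ring
  have h2 : gromovProd z z z' = 0 := by
    unfold gromovProd; rw [dist_self, dist_comm z' z]; ring
  rw [h1, h2, sub_zero] at this
  exact this

/-- `Y` is the injective hull of the jump distance. The lower bound on quasiconvex sets is
`dist_le_orbitDist`; the Hausdorff bound holds because points of `[x, y]` stay coarsely between the
endpoints in `Y`. -/
theorem exists_cobounded (G : Type u) [Group G] (X : Type v) [MetricSpace X] [MulAction G X]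
    [IsIsometricSMul G X] [IsHyperbolicSpace X] (o : X) (Q : ℝ) (hQ : 0 ≤ Q) :
    ∃ K : ℝ, 0 < K ∧
      ∃ (Y : Type v) (_ : MetricSpace Y) (_ : MulAction G Y) (_ : IsIsometricSMul G Y)
        (_ : IsHyperbolicSpace Y) (π : X → Y),
        IsCobounded G Y ∧ (∀ (g : G) (x : X), π (g • x) = g • π x) ∧ IsCoarselyLipschitz π ∧
        (∀ Z : Set X, Z ⊆ MulAction.orbit G o → IsQuasiconvex Q Z →
          IsQIEmbedding K K (fun z : Z => π z)) ∧
        ∃ D : ℝ, ∀ (x y : X) (γ : ℝ → X), IsGeodesic γ x y →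
          ∀ γ' : ℝ → Y, IsGeodesic γ' (π x) (π y) →
            Metric.hausdorffEDist (π '' segment γ x y) (segment γ' (π x) (π y)) ≤
              ENNReal.ofReal D := by
  obtain ⟨δ, hδ, hG⟩ := exists_isGromovHyp X
  have hX := hG.fourPoint
  have hκ : 0 ≤ 2 * δ := by linarith
  set κ := 2 * δ
  set R := Q + 4 * κ with hR
  have hR0 : 0 ≤ R := by positivity
  have hJ := isJump_orbitJump (G := G) o R
  set P := orbitDist G o R with hP
  obtain ⟨κ', hκ', h4⟩ := hJ.exists_fourPoint
  have h4 : FourPoint κ' P.d := h4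
  have hcg := orbitDist_isCoarselyGeodesic (G := G) o R
  have : Nonempty X := ⟨o⟩
  have hY : IsHyperbolicSpace P.Hull := InvariantDist.Hull.isHyperbolicSpace hκ' h4 hcg
  have hle : ∀ x y, P.d x y ≤ dist x y + 1 := hJ.jumpDist_le_dist
  set π := InvariantDist.Hull.of P with hπ
  refine ⟨κ + 1, by positivity, P.Hull, inferInstance, inferInstance, inferInstance, hY,
    π, ?_, InvariantDist.Hull.smul_of, ⟨1, fun x y => ?_⟩, ?_, ?_⟩
  · refine ⟨π o, κ' + 2 + (R + 4), fun f => ?_⟩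
    obtain ⟨m, hm⟩ := InvariantDist.Hull.exists_dist_of_le hκ' h4 hcg f
    obtain ⟨g, hg⟩ := exists_orbitDist_le (G := G) o hR0 m
    refine ⟨g, ?_⟩
    rw [← InvariantDist.Hull.smul_of]
    refine (dist_triangle _ (π m) _).trans (add_le_add hm ?_)
    rw [InvariantDist.Hull.dist_of]
    exact hg
  · rw [InvariantDist.Hull.dist_of, one_mul]
    exact hle x y
  · intro Z hZ hZQ
    refine ⟨by positivity, fun z z' => ?_⟩
    rw [InvariantDist.Hull.dist_of, Subtype.dist_eq]
    obtain ⟨γ, hγ⟩ := IsHyperbolicSpace.geodesic (z : X) z'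
    have h1 : dist (z : X) z' ≤ (κ + 1) * P.d z z' := by
      refine dist_le_orbitDist hκ hX hγ fun p hp => ?_
      obtain ⟨w, hw, hpw⟩ := hZQ z z.2 z' z'.2 γ hγ p hp
      obtain ⟨g, rfl⟩ := hZ hw
      exact ⟨g, hpw⟩
    constructor
    · have h2 : (κ + 1)⁻¹ * dist (z : X) z' ≤ P.d z z' := by
        rw [inv_mul_le_iff₀ (by positivity)]; exact h1
      linarith
    · have h2 := mul_nonneg hκ (dist_nonneg (x := (z : X)) (y := z'))
      linarith [hle z z']
  · obtain ⟨δ', hδ', hG'⟩ := exists_isGromovHyp P.Hull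
    have hX' := hG'.fourPoint
    obtain ⟨C, hC0, hC⟩ := hJ.exists_jumpDist_add_le
    have hC : ∀ (x y : X) (γ : ℝ → X), IsGeodesic γ x y → ∀ p ∈ segment γ x y,
      dist (π x) (π p) + dist (π p) (π y) ≤ dist (π x) (π y) + C := by
      simp only [hπ, InvariantDist.Hull.dist_of]; exact hC
    refine ⟨C + 2 * δ' + 1, fun x y γ hγ γ' hγ' => ?_⟩
    have hed : ∀ {a b : P.Hull}, dist a b ≤ C + 2 * δ' + 1 →
        edist a b ≤ ENNReal.ofReal (C + 2 * δ' + 1) := fun h => by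
      rw [edist_dist]; exact ENNReal.ofReal_le_ofReal h
    refine Metric.hausdorffEDist_le_of_mem_edist ?_ ?_
    · rintro _ ⟨p, hp, rfl⟩
      obtain ⟨q, hq, hpq⟩ := hγ'.exists_near hX' (hC x y γ hγ p hp) (by linarith)
      exact ⟨q, hq, hed (by linarith)⟩
    · rintro _ ⟨t, ht, rfl⟩
      -- Discrete intermediate value argument: along unit steps the distance to `π x` grows by at
      -- most 1 at a time, so the first sample that reaches `t` overshoots by at most 1.
      set σ : ℕ → X := fun i => γ (min i (dist x y)) with hσ
      have hmem : ∀ i : ℕ, min (i : ℝ) (dist x y) ∈ Icc 0 (dist x y) := fun i =>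
        ⟨le_min i.cast_nonneg dist_nonneg, min_le_right _ _⟩
      have hσ1 : ∀ i, dist (π (σ i)) (π (σ (i + 1))) ≤ 1 := fun i => by
        rw [InvariantDist.Hull.dist_of]
        have : jumpDist (OrbitJump G o R) (σ i) (σ (i + 1)) ≤ 1 := by
          refine jumpDist_le_one (hJ.near _ _ ?_)
          rw [hγ.2.2 _ (hmem i) _ (hmem (i + 1))]
          refine (abs_min_sub_min_le_max _ _ _ _).trans ?_
          push_cast; simp
        show (jumpDist (OrbitJump G o R) (σ i) (σ (i + 1)) : ℝ) ≤ 1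
        exact_mod_cast this
      have hex : ∃ i, t ≤ dist (π x) (π (σ i)) := by
        obtain ⟨i, hi⟩ := exists_nat_ge (dist x y)
        refine ⟨i, ?_⟩
        simp only [hσ]
        rw [min_eq_right hi, hγ.2.1]
        exact ht.2
      classical
      have hs := Nat.find_spec hex
      have hmin := fun j => Nat.find_min hex (m := j)
      set i := Nat.find hex
      have hi : dist (π x) (π (σ i)) ≤ t + 1 := by
        rcases Nat.eq_zero_or_pos i with h0 | h0
        · have : σ i = x := by
            simp only [hσ, h0, Nat.cast_zero]
            rw [min_eq_left dist_nonneg, hγ.1]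
          rw [this, dist_self]
          linarith [ht.1]
        · have h1 := hmin (i - 1) (by omega)
          have h2 := hσ1 (i - 1)
          rw [Nat.sub_add_cancel h0] at h2
          linarith [dist_triangle (π x) (π (σ (i - 1))) (π (σ i))]
      have hseg : σ i ∈ segment γ x y := ⟨_, hmem i, rfl⟩
      refine ⟨π (σ i), ⟨_, hseg, rfl⟩, hed ?_⟩
      rw [dist_comm]
      have h1 := hC x y γ hγ _ hseg
      rcases hγ'.dist_le_or hX' ht (π (σ i)) with h2 | h2 <;> linarith

end

/-! ### Loxodromic elements -/

/-- A sequence of points that makes enough progress at each second step makes progress forever. -/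
theorem IsGromovHyp.local_to_global {X : Type v} [MetricSpace X] {δ K : ℝ} (hX : IsGromovHyp X δ)
    (hK : 2 * δ < K) (x : ℕ → X)
    (h₁ : ∀ i, dist (x i) (x (i + 1)) + K ≤ dist (x i) (x (i + 2)))
    (h₂ : ∀ i, dist (x (i + 1)) (x (i + 2)) + K ≤ dist (x i) (x (i + 2))) (n : ℕ) :
    dist (x 0) (x n) + (K - 2 * δ) ≤ dist (x 0) (x (n + 1)) ∧
      gromovProd (x (n + 1)) (x 0) (x (n + 2)) ≤
        gromovProd (x (n + 1)) (x n) (x (n + 2)) + δ := by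
  have hδ := hX.nonneg (x 0)
  -- Seen from `x (n + 1)`, progress makes `x 0` and `x n` nearly aligned, more than `x n` and `x (n
  -- + 2)`. Hyperbolicity therefore prevents `x 0` and `x (n + 2)` from being aligned.
  have step : ∀ n, dist (x 0) (x n) + (K - 2 * δ) ≤ dist (x 0) (x (n + 1)) →
      gromovProd (x (n + 1)) (x 0) (x (n + 2)) ≤
        gromovProd (x (n + 1)) (x n) (x (n + 2)) + δ := by
    intro n hn
    rcases hX.le_or (x (n + 1)) (x n) (x 0) (x (n + 2)) with h | h
    · exfalso
      have h3 := h₁ n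
      have h4 := h₂ n
      unfold gromovProd at h
      rw [dist_comm (x n) (x 0), dist_comm (x (n + 2)) (x (n + 1))] at h
      linarith
    · exact h
  have main : ∀ n, dist (x 0) (x n) + (K - 2 * δ) ≤ dist (x 0) (x (n + 1)) := fun n => by
    induction n with
    | zero =>
      have h3 := h₂ 0
      have h4 := dist_triangle (x 0) (x 1) (x 2)
      simp only [zero_add, dist_self] at *
      linarith
    | succ n ih =>
      have h3 := step n ih
      have h4 := h₁ n
      unfold gromovProd at h3
      rw [dist_comm (x (n + 2)) (x (n + 1))] at h3
      show dist (x 0) (x (n + 1)) + (K - 2 * δ) ≤ dist (x 0) (x (n + 2))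
      linarith
  exact ⟨main n, step n (main n)⟩

section

variable {G : Type u} [Group G] {X : Type v} [MetricSpace X] [MulAction G X] [IsIsometricSMul G X]

theorem dist_smul_smul (g h : G) (o : X) : dist (g • o) (h • o) = dist o ((g⁻¹ * h) • o) := by
  rw [← dist_smul g o, smul_smul, mul_inv_cancel_left]

theorem dist_inv_smul (g : G) (o : X) : dist o (g⁻¹ • o) = dist o (g • o) := by
  rw [← dist_smul g, smul_inv_smul, dist_comm]

theorem dist_zpow_smul (g : G) (o : X) (n : ℤ) :
    dist o (g ^ n • o) = dist o (g ^ n.natAbs • o) := by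
  rcases Int.natAbs_eq n with h | h
  · conv_lhs => rw [h]
    rw [zpow_natCast]
  · conv_lhs => rw [h]
    rw [zpow_neg, dist_inv_smul, zpow_natCast]

theorem dist_zpow_zpow (g : G) (o : X) (i j : ℤ) :
    dist (g ^ i • o) (g ^ j • o) = dist o (g ^ (j - i).natAbs • o) := by
  rw [dist_smul_smul, ← zpow_neg, ← zpow_add, dist_zpow_smul]
  congr 4; ring

theorem dist_pow_add (g : G) (o : X) (i j : ℕ) :
    dist (g ^ i • o) (g ^ (i + j) • o) = dist o (g ^ j • o) := by
  rw [pow_add, mul_smul, dist_smul]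

theorem dist_pow_le (g : G) (o : X) (n : ℕ) : dist o (g ^ n • o) ≤ n * dist o (g • o) := by
  induction n with
  | zero => simp
  | succ n ih =>
    have h1 := dist_triangle o (g ^ n • o) (g ^ (n + 1) • o)
    rw [dist_pow_add, pow_one] at h1
    push_cast
    linarith

theorem dist_pow_add_le (g : G) (o : X) (i j : ℕ) :
    dist o (g ^ (i + j) • o) ≤ dist o (g ^ i • o) + j * dist o (g • o) := by
  have h1 := dist_triangle o (g ^ i • o) (g ^ (i + j) • o)
  rw [dist_pow_add] at h1
  linarith [dist_pow_le g o j]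

theorem dist_pow_le_add (g : G) (o : X) (i j : ℕ) :
    dist o (g ^ i • o) ≤ dist o (g ^ (i + j) • o) + j * dist o (g • o) := by
  have h1 := dist_triangle o (g ^ (i + j) • o) (g ^ i • o)
  rw [dist_comm (g ^ (i + j) • o), dist_pow_add] at h1
  linarith [dist_pow_le g o j]

theorem dist_smul_self_le (g : G) (o x : X) :
    dist o (g • o) ≤ dist x (g • x) + 2 * dist o x := by
  have h1 := dist_triangle4 o x (g • x) (g • o)
  rw [dist_smul, dist_comm x o] at h1
  linarith

/-- The upper bound is automatic from the triangle inequality, and by invariance `dist (g ^ i • o)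
(g ^ j • o)` depends only on `|i - j|`. -/
theorem isLoxodromic_iff (g : G) (o : X) : IsLoxodromic X g ↔
    ∃ ε > 0, ∃ C : ℝ, ∀ n : ℕ, ε * n - C ≤ dist o (g ^ n • o) := by
  constructor
  · rintro ⟨x, L, C, hL, h⟩
    refine ⟨L⁻¹, inv_pos.2 hL, C + 2 * dist x o, fun n => ?_⟩
    have h1 := (h 0 n).1
    have h2 := dist_smul_self_le (g ^ n) x o
    simp only [zpow_zero, one_smul, zpow_natCast] at h1
    rw [Int.dist_eq, Int.cast_zero, zero_sub, abs_neg,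
      Int.cast_natCast, Nat.abs_cast] at h1
    linarith
  · rintro ⟨ε, hε, C, h⟩
    have hℓ : 0 ≤ dist o (g • o) := dist_nonneg
    have hL : 0 < ε⁻¹ + dist o (g • o) := by positivity
    refine ⟨o, ε⁻¹ + dist o (g • o), |C|, hL, fun i j => ?_⟩
    rw [dist_zpow_zpow, Int.dist_eq, abs_sub_comm, ← Int.cast_sub, ← Int.cast_abs,
      Int.abs_eq_natAbs, Int.cast_natCast]
    set n := (j - i).natAbs
    constructor
    · have h1 : (ε⁻¹ + dist o (g • o))⁻¹ ≤ ε := by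
        rw [inv_le_comm₀ hL hε]; linarith
      have h2 := mul_le_mul_of_nonneg_right h1 (Nat.cast_nonneg (α := ℝ) n)
      linarith [h n, le_abs_self C]
    · have h1 : 0 ≤ ε⁻¹ * (n : ℝ) := by positivity
      linarith [dist_pow_le g o n, abs_nonneg C]

/-- The points `gⁿ o` lie coarsely on a line and go to infinity. -/
def HasAxis (g : G) (o : X) (c : ℝ) : Prop :=
  (∀ i j : ℕ, dist o (g ^ i • o) + dist o (g ^ j • o) ≤ dist o (g ^ (i + j) • o) + c) ∧
    Tendsto (fun n : ℕ => dist o (g ^ n • o)) atTop atTop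

/-- Otherwise each doubling of the exponent adds less than `K`, so the displacement of `g ^ 2 ^ k`
grows at most linearly in `k`, against linear growth in `2 ^ k`. -/
theorem exists_dist_sq {g : G} (hg : IsLoxodromic X g) (o : X) (K : ℝ) :
    ∃ N : ℕ, dist o (g ^ N • o) + K ≤ dist o (g ^ (2 * N) • o) := by
  obtain ⟨ε, hε, C, h⟩ := (isLoxodromic_iff g o).1 hg
  by_contra! hcon
  have h1 : ∀ k : ℕ, dist o (g ^ 2 ^ k • o) ≤ dist o (g • o) + k * K := fun k => by
    induction k with
    | zero => simp
    | succ k ih =>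
      have := hcon (2 ^ k)
      rw [← pow_succ'] at this
      push_cast
      linarith
  have h2 := tendsto_pow_const_div_const_pow_of_one_lt 1 (one_lt_two (α := ℝ))
  set A := |dist o (g • o)| + |C| + |K| + 1 with hA
  have hA0 : 0 < A := by positivity
  obtain ⟨k, hk, hk1⟩ := ((h2.eventually_lt_const (div_pos hε hA0)).and
    (eventually_ge_atTop 1)).exists
  rw [pow_one, div_lt_div_iff₀ (by positivity) hA0] at hk
  have h3 := h1 k
  have h4 := h (2 ^ k)
  have hk1' : (1 : ℝ) ≤ k := by exact_mod_cast hk1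
  push_cast at h4
  have h5 : dist o (g • o) ≤ |dist o (g • o)| * k :=
    (le_abs_self _).trans (le_mul_of_one_le_right (abs_nonneg _) hk1')
  have h6 : C ≤ |C| * k := (le_abs_self _).trans (le_mul_of_one_le_right (abs_nonneg _) hk1')
  have h7 : k * K ≤ |K| * k := by
    rw [mul_comm]; exact mul_le_mul_of_nonneg_right (le_abs_self _) (by linarith)
  rw [hA] at hk
  linarith

theorem hasAxis_of_dist_sq {δ : ℝ} (hX : IsGromovHyp X δ) {g : G} {o : X}
    (h : dist o (g • o) + (4 * δ + 1) ≤ dist o (g ^ 2 • o)) :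
    (∀ n : ℕ, n * (2 * δ + 1) ≤ dist o (g ^ n • o)) ∧
      ∀ i j : ℕ, dist o (g ^ i • o) + dist o (g ^ j • o) ≤
        dist o (g ^ (i + j) • o) + dist o (g • o) := by
  have hδ := hX.nonneg o
  have hd1 : ∀ i, dist (g ^ i • o) (g ^ (i + 1) • o) = dist o (g • o) := fun i => by
    rw [dist_pow_add, pow_one]
  have main := hX.local_to_global (K := 4 * δ + 1) (by linarith) (fun i => g ^ i • o)
    (fun i => by
      show dist (g ^ i • o) (g ^ (i + 1) • o) + _ ≤ dist (g ^ i • o) (g ^ (i + 2) • o)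
      rw [hd1, dist_pow_add]; exact h)
    (fun i => by
      show dist (g ^ (i + 1) • o) (g ^ (i + 1 + 1) • o) + _ ≤ dist (g ^ i • o) (g ^ (i + 2) • o)
      rw [hd1, dist_pow_add]; exact h)
  simp only [pow_zero, one_smul] at main
  have hinc : ∀ n, dist o (g ^ n • o) + (2 * δ + 1) ≤ dist o (g ^ (n + 1) • o) := fun n => by
    linarith [(main n).1]
  refine ⟨fun n => ?_, fun i j => ?_⟩
  · induction n with
    | zero => simp
    | succ n ih => push_cast; linarith [hinc n]
  · have h0 : dist o (g ^ 0 • o) = 0 := by simp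
    have hℓ : 0 ≤ dist o (g • o) := dist_nonneg
    rcases i with _ | n
    · rw [h0, zero_add, zero_add]; linarith
    rcases j with _ | k
    · rw [h0]; simp
    have h1 := (main n).2
    have h2 := hinc k
    have e1 := hd1 n
    have e2 := hd1 (n + 1)
    have e3 := dist_pow_add g o n 2
    have e4 := dist_pow_add g o (n + 1) (k + 1)
    have e5 : dist (g ^ (n + 1 + 1) • o) (g ^ (n + 1 + (k + 1)) • o) = dist o (g ^ k • o) := by
      rw [show n + 1 + (k + 1) = n + 1 + 1 + k by ring, dist_pow_add]
    rcases hX.le_or (g ^ (n + 1) • o) o (g ^ (n + 1 + (k + 1)) • o) (g ^ (n + 2) • o) with h3 | h3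
    all_goals
      unfold gromovProd at h1 h3
      rw [dist_comm (g ^ (n + 1) • o) (g ^ (n + 1 + (k + 1)) • o)] at e4
      rw [dist_comm (g ^ (n + 2) • o) (g ^ (n + 1) • o)] at h1 h3
      try rw [dist_comm (g ^ (n + 1 + (k + 1)) • o) (g ^ (n + 2) • o)] at h3
      linarith

theorem isLoxodromic_of_dist_sq {δ : ℝ} (hX : IsGromovHyp X δ) {g : G} {o : X}
    (h : dist o (g • o) + (4 * δ + 1) ≤ dist o (g ^ 2 • o)) : IsLoxodromic X g := by
  have hδ := hX.nonneg o
  refine (isLoxodromic_iff g o).2 ⟨2 * δ + 1, by positivity, 0, fun n => ?_⟩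
  have := (hasAxis_of_dist_sq hX h).1 n
  linarith

/-- Some power `g ^ N` satisfies the local criterion of `hasAxis_of_dist_sq`. Division with
remainder by `N` extends the estimate to all exponents at bounded cost. -/
theorem IsLoxodromic.exists_hasAxis [IsHyperbolicSpace X] {g : G} (hg : IsLoxodromic X g) (o : X) :
    ∃ c, HasAxis g o c := by
  obtain ⟨δ, hδ, hX⟩ := exists_isGromovHyp X
  obtain ⟨N, hN⟩ := exists_dist_sq hg o (4 * δ + 1)
  have hN0 : 0 < N := by
    rcases Nat.eq_zero_or_pos N with rfl | h
    · simp at hN; linarith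
    · exact h
  have hax := (hasAxis_of_dist_sq hX (g := g ^ N) (o := o) (by
    rw [← pow_mul, mul_comm N]; exact hN)).2
  have hℓ : 0 ≤ dist o (g • o) := dist_nonneg
  refine ⟨dist o (g ^ N • o) + 4 * N * dist o (g • o), fun i j => ?_, ?_⟩
  · have h1 := dist_pow_add_le g o (N * (i / N)) (i % N)
    have h2 := dist_pow_add_le g o (N * (j / N)) (j % N)
    have h3 := dist_pow_le_add g o (N * (i / N + j / N)) (i % N + j % N)
    have h4 := hax (i / N) (j / N)
    rw [← pow_mul, ← pow_mul, ← pow_mul] at h4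
    rw [Nat.div_add_mod] at h1 h2
    rw [show N * (i / N + j / N) + (i % N + j % N) = i + j by
      conv_rhs => rw [← Nat.div_add_mod i N, ← Nat.div_add_mod j N]
      ring] at h3
    have h5 : ((i % N : ℕ) : ℝ) ≤ N := by exact_mod_cast (Nat.mod_lt i hN0).le
    have h6 : ((j % N : ℕ) : ℝ) ≤ N := by exact_mod_cast (Nat.mod_lt j hN0).le
    have h7 := mul_le_mul_of_nonneg_right h5 hℓ
    have h8 := mul_le_mul_of_nonneg_right h6 hℓ
    push_cast at h3
    linarith
  · obtain ⟨ε, hε, C, h⟩ := (isLoxodromic_iff g o).1 hg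
    refine tendsto_atTop_mono h (tendsto_atTop_add_const_right _ (-C) ?_)
    exact tendsto_natCast_atTop_atTop.const_mul_atTop hε

theorem IsLoxodromic.inv {g : G} (hg : IsLoxodromic X g) : IsLoxodromic X g⁻¹ := by
  obtain ⟨o, -⟩ := id hg
  obtain ⟨ε, hε, C, h⟩ := (isLoxodromic_iff g o).1 hg
  refine (isLoxodromic_iff _ o).2 ⟨ε, hε, C, fun n => ?_⟩
  rw [inv_pow, dist_inv_smul]
  exact h n

theorem IsLoxodromic.conj {g : G} (hg : IsLoxodromic X g) (k : G) :
    IsLoxodromic X (k * g * k⁻¹) := by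
  obtain ⟨o, -⟩ := id hg
  obtain ⟨ε, hε, C, h⟩ := (isLoxodromic_iff g o).1 hg
  refine (isLoxodromic_iff _ (k • o)).2 ⟨ε, hε, C, fun n => ?_⟩
  rw [conj_pow, smul_smul, inv_mul_cancel_right, mul_smul, dist_smul]
  exact h n

/-- If the action has no loxodromic element, any two long orbit displacements have a large Gromov
product. -/
theorem min_dist_le_of_not_isLoxodromic {δ : ℝ} (hX : IsGromovHyp X δ)
    (hG : ∀ g : G, ¬ IsLoxodromic X g) (o : X) (g h : G) :
    min (dist o (g • o)) (dist o (h • o)) ≤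
      2 * gromovProd o (g • o) (h • o) + (6 * δ + 1) := by
  by_contra! hlt
  rw [lt_min_iff] at hlt
  have hδ := hX.nonneg o
  have hsq : ∀ g : G, dist o (g ^ 2 • o) < dist o (g • o) + (4 * δ + 1) := fun g => by
    by_contra! h
    exact hG g (isLoxodromic_of_dist_sq hX h)
  have hinv : ∀ g : G, dist (g • o) (g⁻¹ • o) = dist o (g ^ 2 • o) := fun g => by
    rw [dist_comm, dist_smul_smul, inv_inv, sq]
  have s1 := hsq g
  have s2 := hsq h
  rw [← hinv] at s1 s2
  have i1 := dist_inv_smul g o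
  have i2 := dist_inv_smul h o
  have c1 := dist_comm o (g • o)
  have c2 := dist_comm o (h • o)
  have c3 := dist_comm o (g⁻¹ • o)
  have c4 := dist_comm o (h⁻¹ • o)
  -- As `g` is not loxodromic, `g • o` and `g⁻¹ • o` are nearly aligned from `o`, so `g⁻¹ • o` can
  -- replace `g • o`.
  have p1 : gromovProd o (g⁻¹ • o) (h • o) ≤ gromovProd o (g • o) (h • o) + δ := by
    rcases hX.le_or o (g • o) (g⁻¹ • o) (h • o) with h1 | h1
    · exfalso
      have h2 := hlt.1
      generalize gromovProd o (g • o) (h • o) = e at *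
      unfold gromovProd at h1
      linarith
    · exact h1
  have p2 : gromovProd o (g • o) (h⁻¹ • o) ≤ gromovProd o (g • o) (h • o) + δ := by
    rcases hX.le_or o (g • o) (h⁻¹ • o) (h • o) with h1 | h1
    · exact h1
    · exfalso
      have h2 := hlt.2
      generalize gromovProd o (g • o) (h • o) = e at *
      unfold gromovProd at h1
      rw [dist_comm (h⁻¹ • o) (h • o)] at h1
      linarith
  have d1 : dist (g⁻¹ • o) (h • o) = dist o ((g * h) • o) := by
    rw [dist_smul_smul, inv_inv]
  have d2 : dist (g • o) (h⁻¹ • o) = dist o ((h * g) • o) := by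
    rw [dist_comm, dist_smul_smul, inv_inv]
  set e := gromovProd o (g • o) (h • o)
  unfold gromovProd at p1 p2
  rw [d1] at p1
  rw [d2] at p2
  -- The broken path `o, go, gho, ghgo, ...` turns little at each vertex, so it makes progress
  -- forever and `g * h` is loxodromic, a contradiction.
  set x : ℕ → X := fun n => (g * h) ^ (n / 2) • (if n % 2 = 0 then o else g • o) with hx
  have x0 : ∀ i, x (2 * i) = (g * h) ^ i • o := fun i => by
    simp only [hx]
    rw [if_pos (by omega), show 2 * i / 2 = i by omega]
  have x1 : ∀ i, x (2 * i + 1) = (g * h) ^ i • g • o := fun i => by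
    simp only [hx]
    rw [if_neg (by omega), show (2 * i + 1) / 2 = i by omega]
  have y01 : ∀ i, dist (x (2 * i)) (x (2 * i + 1)) = dist o (g • o) := fun i => by
    rw [x0, x1, dist_smul]
  have y12 : ∀ i, dist (x (2 * i + 1)) (x (2 * i + 2)) = dist o (h • o) := fun i => by
    rw [show 2 * i + 2 = 2 * (i + 1) by ring, x0, x1, pow_succ, mul_smul, dist_smul, mul_smul,
      dist_smul]
  have y02 : ∀ i, dist (x (2 * i)) (x (2 * i + 2)) = dist o ((g * h) • o) := fun i => by
    rw [show 2 * i + 2 = 2 * (i + 1) by ring, x0, x0, pow_succ, mul_smul, dist_smul]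
  have y13 : ∀ i, dist (x (2 * i + 1)) (x (2 * i + 3)) = dist o ((h * g) • o) := fun i => by
    rw [show 2 * i + 3 = 2 * (i + 1) + 1 by ring, x1, x1, pow_succ, mul_smul, dist_smul,
      mul_smul g h, dist_smul, mul_smul]
  have y23 : ∀ i, dist (x (2 * i + 2)) (x (2 * i + 3)) = dist o (g • o) := fun i => y01 (i + 1)
  have main := hX.local_to_global (K := 4 * δ + 1) (by linarith) x
    (fun i => by
      rcases Nat.even_or_odd' i with ⟨j, rfl | rfl⟩
      · rw [y01, y02]; linarith
      · rw [show 2 * j + 1 + 1 = 2 * j + 2 by ring, show 2 * j + 1 + 2 = 2 * j + 3 by ring,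
          y12, y13]; linarith)
    (fun i => by
      rcases Nat.even_or_odd' i with ⟨j, rfl | rfl⟩
      · rw [y12, y02]; linarith
      · rw [show 2 * j + 1 + 1 = 2 * j + 2 by ring, show 2 * j + 1 + 2 = 2 * j + 3 by ring,
          y23, y13]; linarith)
  have grow : ∀ n : ℕ, n * (2 * δ + 1) ≤ dist (x 0) (x n) := fun n => by
    induction n with
    | zero => simp
    | succ n ih => push_cast; linarith [(main n).1]
  refine hG (g * h) ((isLoxodromic_iff _ o).2 ⟨1, one_pos, 0, fun n => ?_⟩)
  have := grow (2 * n)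
  rw [x0, show x 0 = o by simp [hx]] at this
  push_cast at this
  have h3 : 0 ≤ (n : ℝ) * (4 * δ) := by positivity
  have h4 : (0 : ℝ) ≤ n := n.cast_nonneg
  linarith

/-- A cobounded action without loxodromic elements is bounded. -/
theorem exists_dist_le_of_not_isLoxodromic [IsHyperbolicSpace X] (hc : IsCobounded G X)
    (hG : ∀ g : G, ¬ IsLoxodromic X g) : ∃ B : ℝ, ∀ x y : X, dist x y ≤ B := by
  obtain ⟨δ, hδ, hX⟩ := exists_isGromovHyp X
  obtain ⟨o, R, hR⟩ := hc
  have key : ∀ g : G, dist o (g • o) ≤ 6 * R + 2 * (6 * δ + 1) := by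
    intro g
    obtain ⟨γ, hγ⟩ := IsHyperbolicSpace.geodesic o (g • o)
    set D := dist o (g • o) with hD
    have hD0 : 0 ≤ D := dist_nonneg
    have ht : D / 2 ∈ Icc 0 D := ⟨by linarith, by linarith⟩
    -- Seen from an orbit point `k • o` near the midpoint, `o` and `g • o` are both about `D / 2`
    -- away but have Gromov product at most `R`. Absence of loxodromics then bounds `D`.
    obtain ⟨k, hk⟩ := hR (γ (D / 2))
    have h1 := min_dist_le_of_not_isLoxodromic hX hG o k⁻¹ (k⁻¹ * g)
    have e1 : dist (k⁻¹ • o) ((k⁻¹ * g) • o) = D := by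
      rw [mul_smul, dist_smul]
    have e2 : dist (k⁻¹ • o) o = dist o (k • o) := by
      rw [dist_comm, dist_inv_smul]
    have e3 : dist ((k⁻¹ * g) • o) o = dist (k • o) (g • o) := by
      rw [dist_comm, ← dist_smul_smul]
    have h2 := hγ.dist_left ht
    have h3 := hγ.dist_right ht
    have t1 := dist_triangle o (k • o) (γ (D / 2))
    have t2 := dist_triangle (γ (D / 2)) (k • o) (g • o)
    have t3 := dist_triangle o (γ (D / 2)) (k • o)
    have t4 := dist_triangle (k • o) (γ (D / 2)) (g • o)
    rw [dist_comm (k • o) (γ (D / 2))] at t1 t4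
    unfold gromovProd at h1
    rw [e1, e2, e3, dist_comm o (k⁻¹ • o), dist_comm o ((k⁻¹ * g) • o), e2, e3] at h1
    rcases min_le_iff.1 h1 with h | h <;> linarith
  refine ⟨R + (6 * R + 2 * (6 * δ + 1)) + R, fun x y => ?_⟩
  obtain ⟨g, hg⟩ := hR x
  obtain ⟨h, hh⟩ := hR y
  have h1 := dist_triangle4 x (g • o) (h • o) y
  rw [dist_smul_smul, dist_comm (h • o) y] at h1
  linarith [key (g⁻¹ * h)]

end

/-! ### Asymptotic sequences -/

section

variable {X : Type v} [MetricSpace X]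

theorem gromovProd_le_add_base (o o' x y : X) :
    gromovProd o x y ≤ gromovProd o' x y + dist o o' := by
  have h1 := dist_triangle x o' o
  have h2 := dist_triangle y o' o
  rw [dist_comm o' o] at h1 h2
  unfold gromovProd
  linarith

theorem gromovProd_le_add (o x y x' y' : X) :
    gromovProd o x y ≤ gromovProd o x' y' + (dist x x' + dist y y') := by
  have h1 := dist_triangle x x' o
  have h2 := dist_triangle y y' o
  have h3 := dist_triangle4 x' x y y'
  rw [dist_comm x' x] at h3
  unfold gromovProd
  linarith

theorem gromovProd_self (o x : X) : gromovProd o x x = dist x o := by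
  unfold gromovProd; rw [dist_self]; ring

theorem gromovProd_le_dist (o x y : X) : gromovProd o x y ≤ dist o y := by
  have h1 := dist_triangle x y o
  unfold gromovProd
  rw [dist_comm y o] at *
  linarith

theorem asymptotic_iff (o : X) {a b : ℕ → X} : Asymptotic a b ↔
    ∀ M : ℝ, ∃ N : ℕ, ∀ i ≥ N, ∀ j ≥ N, M ≤ gromovProd o (a i) (b j) := by
  constructor
  · intro h M
    obtain ⟨⟨i, j⟩, hN⟩ := eventually_atTop.1 ((h o).eventually_ge_atTop M)
    exact ⟨max i j, fun i' hi j' hj =>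
      hN (i', j') ⟨(le_max_left _ _).trans hi, (le_max_right _ _).trans hj⟩⟩
  · intro h o'
    rw [tendsto_atTop]
    intro M
    obtain ⟨N, hN⟩ := h (M + dist o o')
    refine eventually_atTop.2 ⟨(N, N), fun p hp => ?_⟩
    have h1 := hN p.1 hp.1 p.2 hp.2
    have h2 := gromovProd_le_add_base o o' (a p.1) (b p.2)
    linarith

theorem Asymptotic.of_dist_le {a b a' b' : ℕ → X} (h : Asymptotic a b) {R : ℝ}
    (ha : ∀ n, dist (a n) (a' n) ≤ R) (hb : ∀ n, dist (b n) (b' n) ≤ R) : Asymptotic a' b' := by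
  have o := a 0
  refine (asymptotic_iff o).2 fun M => ?_
  obtain ⟨N, hN⟩ := (asymptotic_iff o).1 h (M + 2 * R)
  refine ⟨N, fun i hi j hj => ?_⟩
  linarith [hN i hi j hj, gromovProd_le_add o (a i) (b j) (a' i) (b' j), ha i, hb j]

theorem ConvergesAtInfinity.exists_le_dist {a : ℕ → X} (h : ConvergesAtInfinity a) (o : X) (M : ℝ) :
    ∃ N : ℕ, ∀ i ≥ N, M ≤ dist (a i) o := by
  obtain ⟨N, hN⟩ := (asymptotic_iff o).1 h M
  exact ⟨N, fun i hi => by simpa only [gromovProd_self] using hN i hi i hi⟩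

/-- Sequences with different limits have bounded Gromov products. -/
theorem exists_gromovProd_le {δ : ℝ} (hX : IsGromovHyp X δ) {a b : ℕ → X}
    (ha : ConvergesAtInfinity a) (hb : ConvergesAtInfinity b) (h : ¬ Asymptotic a b) (o : X) :
    ∃ M : ℝ, ∃ N : ℕ, ∀ i ≥ N, ∀ j ≥ N, gromovProd o (a i) (b j) ≤ M := by
  rw [asymptotic_iff o] at h
  push Not at h
  obtain ⟨M, hM⟩ := h
  have hδ := hX.nonneg o
  obtain ⟨N₁, h₁⟩ := (asymptotic_iff o).1 ha (M + 2 * δ)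
  obtain ⟨N₂, h₂⟩ := (asymptotic_iff o).1 hb (M + 2 * δ)
  refine ⟨M + 2 * δ, max N₁ N₂, fun i hi j hj => ?_⟩
  obtain ⟨i', hi', j', hj', hlt⟩ := hM (max N₁ N₂)
  have e1 := h₁ i' ((le_max_left _ _).trans hi') i ((le_max_left _ _).trans hi)
  have e2 := h₂ j ((le_max_right _ _).trans hj) j' ((le_max_right _ _).trans hj')
  rcases hX.le_or o (a i') (a i) (b j') with h | h
  · linarith
  · rcases hX.le_or o (a i) (b j) (b j') with h' | h' <;> linarith

end

/-! ### Endpoints of loxodromic elements -/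

section

variable {G : Type u} [Group G] {X : Type v} [MetricSpace X] [MulAction G X] [IsIsometricSMul G X]

theorem HasAxis.le_gromovProd {g : G} {o : X} {c : ℝ} (h : HasAxis g o c) {i j : ℕ} (hij : i ≤ j) :
    dist o (g ^ i • o) - c / 2 ≤ gromovProd o (g ^ i • o) (g ^ j • o) := by
  obtain ⟨k, rfl⟩ := Nat.exists_eq_add_of_le hij
  have h1 := h.1 i k
  unfold gromovProd
  rw [dist_pow_add, dist_comm (g ^ i • o) o, dist_comm (g ^ (i + k) • o) o]
  linarith

theorem HasAxis.gromovProd_inv_le {g : G} {o : X} {c : ℝ} (h : HasAxis g o c) (i j : ℕ) :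
    gromovProd o (g ^ i • o) (g⁻¹ ^ j • o) ≤ c / 2 := by
  have h1 := h.1 i j
  have h2 : dist (g ^ i • o) (g⁻¹ ^ j • o) = dist o (g ^ (i + j) • o) := by
    rw [dist_comm, dist_smul_smul, inv_pow, inv_inv, ← pow_add, add_comm]
  unfold gromovProd
  rw [h2, dist_comm _ o, dist_comm _ o, inv_pow, dist_inv_smul]
  linarith

theorem HasAxis.convergesAtInfinity {g : G} {o : X} {c : ℝ} (h : HasAxis g o c) :
    ConvergesAtInfinity fun n : ℕ => g ^ n • o := by
  refine (asymptotic_iff o).2 fun M => ?_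
  obtain ⟨N, hN⟩ := eventually_atTop.1 (h.2.eventually_ge_atTop (M + c / 2))
  refine ⟨N, fun i hi j hj => ?_⟩
  rcases le_total i j with hij | hij
  · linarith [h.le_gromovProd hij, hN i hi]
  · rw [gromovProd_comm]
    linarith [h.le_gromovProd hij, hN j hj]

/-- The displacements of the powers of `g` take all values up to a bounded error. -/
theorem exists_dist_pow_near (g : G) (o : X) {s : ℝ} (hs : 0 ≤ s) {n : ℕ}
    (h : s ≤ dist o (g ^ n • o)) :
    ∃ j ≤ n, s ≤ dist o (g ^ j • o) ∧ dist o (g ^ j • o) ≤ s + dist o (g • o) := by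
  classical
  have hex : ∃ j, s ≤ dist o (g ^ j • o) := ⟨n, h⟩
  refine ⟨Nat.find hex, Nat.find_min' hex h, Nat.find_spec hex, ?_⟩
  have hmin := fun j => Nat.find_min hex (m := j)
  generalize Nat.find hex = j at *
  rcases j with _ | j
  · simp only [pow_zero, one_smul, dist_self]; positivity
  · have h1 := hmin j (by omega)
    have h2 := dist_pow_add_le g o j 1
    push_cast at h2
    linarith

variable [IsHyperbolicSpace X]

theorem IsLoxodromic.convergesAtInfinity {g : G} (hg : IsLoxodromic X g) (o : X) :
    ConvergesAtInfinity fun n : ℕ => g ^ n • o :=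
  (hg.exists_hasAxis o).elim fun _ h => h.convergesAtInfinity

/-- The attracting point of a loxodromic element. -/
def loxPoint (o : X) {g : G} (hg : IsLoxodromic X g) : Boundary X :=
  Quotient.mk (boundarySetoid X) ⟨fun n => g ^ n • o, hg.convergesAtInfinity o⟩

theorem loxPoint_mem_limitSet (o : X) {g : G} (hg : IsLoxodromic X g) :
    loxPoint o hg ∈ limitSet G X :=
  ⟨o, fun n => g ^ n, hg.convergesAtInfinity o, rfl⟩

theorem loxPoint_ne_inv (o : X) {g : G} (hg : IsLoxodromic X g) :
    loxPoint o hg ≠ loxPoint o hg.inv := by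
  intro h
  have h1 : Asymptotic (fun n => g ^ n • o) (fun n => g⁻¹ ^ n • o) := Quotient.exact h
  obtain ⟨c, hc⟩ := hg.exists_hasAxis o
  obtain ⟨N, hN⟩ := (asymptotic_iff o).1 h1 (c / 2 + 1)
  linarith [hN N le_rfl N le_rfl, hc.gromovProd_inv_le N N]

/-- Keeping the base point `o` turns the action on endpoints into a comparison of rays of `k * g *
k⁻¹` and `g` inside one orbit. -/
theorem smul_loxPoint (o : X) {g : G} (hg : IsLoxodromic X g) (k : G) :
    k • loxPoint o hg = loxPoint o (hg.conj k) := by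
  refine Quotient.sound ?_
  have h1 : Asymptotic (fun n => k • g ^ n • o) (fun n => k • g ^ n • o) :=
    (hg.convergesAtInfinity o).smul k
  show Asymptotic (fun n => k • g ^ n • o) (fun n => (k * g * k⁻¹) ^ n • o)
  refine h1.of_dist_le (R := dist o (k⁻¹ • o)) (fun n => ?_) fun n => ?_
  · rw [dist_self]; exact dist_nonneg
  · rw [conj_pow, mul_smul, mul_smul, dist_smul, dist_smul]

theorem smul_mem_limitSet {ξ : Boundary X} (h : ξ ∈ limitSet G X) (k : G) :
    k • ξ ∈ limitSet G X := by
  obtain ⟨x, g, hg, rfl⟩ := h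
  have h1 : ConvergesAtInfinity fun n => (k * g n) • x := by
    simp only [mul_smul]
    exact Asymptotic.smul hg k
  refine ⟨x, fun n => k * g n, h1, Quotient.sound ?_⟩
  show Asymptotic (fun n => k • g n • x) (fun n => (k * g n) • x)
  simp only [mul_smul]
  exact Asymptotic.smul hg k

/-- A convergent sequence that comes close to the ray `gⁿ o` infinitely often converges to its
endpoint. -/
theorem IsLoxodromic.asymptotic_of_near {g : G} (hg : IsLoxodromic X g) (o : X) {a : ℕ → X}
    (ha : ConvergesAtInfinity a) (R : ℝ)
    (h : ∀ N : ℕ, ∃ i ≥ N, ∃ m : ℕ, dist (a i) (g ^ m • o) ≤ R) :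
    Asymptotic a fun n => g ^ n • o := by
  by_contra hcon
  obtain ⟨δ, hδ, hX⟩ := exists_isGromovHyp X
  obtain ⟨M, N, hMN⟩ := exists_gromovProd_le hX ha (hg.convergesAtInfinity o) hcon o
  obtain ⟨N', hN'⟩ := ha.exists_le_dist o (|M| + R + N * dist o (g • o) + 1)
  obtain ⟨i, hi, m, hm⟩ := h (max N N')
  have h1 := hN' i ((le_max_right _ _).trans hi)
  have h2 := dist_triangle (a i) (g ^ m • o) o
  have hℓ : 0 ≤ dist o (g • o) := dist_nonneg
  rw [dist_comm (g ^ m • o) o] at h2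
  have hmN : N ≤ m := by
    by_contra! hlt
    have h3 := dist_pow_le g o m
    have h4 : (m : ℝ) * dist o (g • o) ≤ N * dist o (g • o) :=
      mul_le_mul_of_nonneg_right (by exact_mod_cast hlt.le) hℓ
    linarith [abs_nonneg M]
  have h5 := hMN i ((le_max_left _ _).trans hi) m hmN
  unfold gromovProd at h5
  rw [dist_comm (g ^ m • o) o] at h5
  have h6 : 0 ≤ (N : ℝ) * dist o (g • o) := by positivity
  linarith [le_abs_self M]

theorem loxPoint_eq_of_near (o : X) {g h : G} (hg : IsLoxodromic X g) (hh : IsLoxodromic X h)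
    (R : ℝ) (H : ∀ n : ℕ, ∃ m : ℕ, dist (g ^ n • o) (h ^ m • o) ≤ R) :
    loxPoint o hg = loxPoint o hh :=
  Quotient.sound (hh.asymptotic_of_near o (hg.convergesAtInfinity o) R fun N => ⟨N, le_rfl, H N⟩)

theorem exists_near_of_loxPoint_eq (o : X) {g h : G} (hg : IsLoxodromic X g)
    (hh : IsLoxodromic X h) (H : loxPoint o hg = loxPoint o hh) :
    ∃ R : ℝ, ∀ n : ℕ, ∃ m : ℕ, dist (g ^ n • o) (h ^ m • o) ≤ R := by
  have H : Asymptotic (fun n => g ^ n • o) (fun n => h ^ n • o) := Quotient.exact H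
  obtain ⟨δ, hδ, hX⟩ := exists_isGromovHyp X
  obtain ⟨c, hc⟩ := hg.exists_hasAxis o
  obtain ⟨c', hc'⟩ := hh.exists_hasAxis o
  have hc0 : 0 ≤ c := by simpa using hc.1 0 0
  have hc0' : 0 ≤ c' := by simpa using hc'.1 0 0
  refine ⟨dist o (h • o) + c + c' + 4 * δ, fun n => ?_⟩
  -- `N` is taken so far out that both rays fellow-travel beyond `g ^ n • o`; then `h ^ m • o` is
  -- chosen at nearly the same distance from `o`.
  obtain ⟨N, hN⟩ := (asymptotic_iff o).1 H (dist o (g ^ n • o))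
  have h1 := hN (max n N) (le_max_right _ _) N le_rfl
  have h0 := gromovProd_le_dist o (g ^ max n N • o) (h ^ N • o)
  obtain ⟨m, hm, hm1, hm2⟩ := exists_dist_pow_near h o (dist_nonneg (x := o) (y := g ^ n • o))
    (h1.trans h0)
  have h2 := hc.le_gromovProd (le_max_left n N)
  have h3 := hc'.le_gromovProd hm
  refine ⟨m, ?_⟩
  have h4 : dist o (g ^ n • o) - (c / 2 + c' / 2) - 2 * δ ≤
      gromovProd o (g ^ n • o) (h ^ m • o) := by
    rcases hX.le_or o (g ^ n • o) (g ^ max n N • o) (h ^ m • o) with h5 | h5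
    · linarith
    · rcases hX.le_or o (g ^ max n N • o) (h ^ N • o) (h ^ m • o) with h6 | h6
      · linarith
      · rw [gromovProd_comm] at h6
        linarith
  unfold gromovProd at h4
  rw [dist_comm (g ^ n • o) o, dist_comm (h ^ m • o) o] at h4
  linarith

/-- A loxodromic element fixes only its endpoints. -/
theorem eq_loxPoint_of_smul_eq (o : X) {g : G} (hg : IsLoxodromic X g) {ξ : Boundary X}
    (h : ∀ n : ℕ, g ^ n • ξ = ξ) : ξ = loxPoint o hg ∨ ξ = loxPoint o hg.inv := by
  induction ξ using Quotient.inductionOn with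
  | h a =>
    obtain ⟨a, ha⟩ := a
    by_contra! hcon
    obtain ⟨δ, hδ, hX⟩ := exists_isGromovHyp X
    obtain ⟨c, hc⟩ := hg.exists_hasAxis o
    obtain ⟨M₁, N₁, h₁⟩ := exists_gromovProd_le hX ha (hg.convergesAtInfinity o)
      (fun h' => hcon.1 (Quotient.sound h')) o
    obtain ⟨M₂, N₂, h₂⟩ := exists_gromovProd_le hX ha (hg.inv.convergesAtInfinity o)
      (fun h' => hcon.2 (Quotient.sound h')) o
    -- A point far from the repelling end is pushed by a large power `g ^ p` towards `g ^ p • o`. As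
    -- `g ^ p` fixes the class of `a`, this forces `a` itself towards `g ^ p • o`, beyond `M₁`.
    obtain ⟨p, hp, hpN₁, hpN₂⟩ := ((hc.2.eventually_ge_atTop (M₁ + M₂ + δ + 1)).and
      ((eventually_ge_atTop N₁).and (eventually_ge_atTop N₂))).exists
    have h3 : Asymptotic (fun n => g ^ p • a n) a := Quotient.exact (h p)
    obtain ⟨N₃, h₃⟩ := (asymptotic_iff o).1 h3 (M₁ + δ + 1)
    set i := max (max N₁ N₂) N₃
    have i1 : N₁ ≤ i := (le_max_left _ _).trans (le_max_left _ _)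
    have i2 : N₂ ≤ i := (le_max_right _ _).trans (le_max_left _ _)
    have i3 : N₃ ≤ i := le_max_right _ _
    have e1 := h₁ i i1 p hpN₁
    have e2 := h₂ i i2 p hpN₂
    have e3 := h₃ i i3 i i3
    have e4 : dist o (g ^ p • o) - M₂ ≤ gromovProd o (g ^ p • a i) (g ^ p • o) := by
      have f1 : dist (g ^ p • a i) o = dist (a i) (g⁻¹ ^ p • o) := by
        rw [← dist_smul (g ^ p) (a i), inv_pow, smul_inv_smul]
      have f2 : dist (g⁻¹ ^ p • o) o = dist o (g ^ p • o) := by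
        rw [dist_comm, inv_pow, dist_inv_smul]
      unfold gromovProd at e2 ⊢
      rw [f1, dist_smul, dist_comm (g ^ p • o) o]
      rw [f2] at e2
      linarith
    rcases hX.le_or o (a i) (g ^ p • a i) (g ^ p • o) with h4 | h4
    · rw [gromovProd_comm] at h4
      linarith
    · linarith

/-- A point coarsely between two points of the axis of a loxodromic element is close to the
axis. -/
theorem HasAxis.exists_near {g : G} {o : X} {c : ℝ} (hg : HasAxis g o c) (c₁ : ℝ) :
    ∃ R : ℝ, 0 ≤ R ∧ ∀ (i k : ℤ) (p : X),
      dist (g ^ i • o) p + dist p (g ^ k • o) ≤ dist (g ^ i • o) (g ^ k • o) + c₁ →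
        ∃ j : ℤ, dist p (g ^ j • o) ≤ R := by
  obtain ⟨δ, hδ, hG⟩ := exists_isGromovHyp X
  have hX := hG.fourPoint
  have hℓ : 0 ≤ dist o (g • o) := dist_nonneg
  refine ⟨|c| + |c₁| + dist o (g • o) + 2 * δ, by positivity, ?_⟩
  have key : ∀ (i k : ℤ) (p : X), i ≤ k →
      dist (g ^ i • o) p + dist p (g ^ k • o) ≤ dist (g ^ i • o) (g ^ k • o) + c₁ →
        ∃ j : ℤ, dist p (g ^ j • o) ≤ |c| + |c₁| + dist o (g • o) + 2 * δ := by
    intro i k p hik h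
    obtain ⟨n, rfl⟩ := Int.le.dest hik
    rcases le_total (dist (g ^ i • o) (g ^ (i + n : ℤ) • o)) (dist (g ^ i • o) p) with h1 | h1
    · exact ⟨i + n, by linarith [le_abs_self c₁, abs_nonneg c]⟩
    · rw [dist_zpow_zpow, show (i + n - i : ℤ).natAbs = n by omega] at h h1
      obtain ⟨j, hj, hj1, hj2⟩ := exists_dist_pow_near g o dist_nonneg h1
      refine ⟨i + j, ?_⟩
      have e1 : dist (g ^ i • o) (g ^ (i + j : ℤ) • o) = dist o (g ^ j • o) := by
        rw [dist_zpow_zpow]; congr 3; omega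
      have e2 : dist (g ^ (i + j : ℤ) • o) (g ^ (i + n : ℤ) • o) = dist o (g ^ (n - j) • o) := by
        rw [dist_zpow_zpow]; congr 3; omega
      have e3 : dist (g ^ i • o) (g ^ (i + n : ℤ) • o) = dist o (g ^ n • o) := by
        rw [dist_zpow_zpow]; congr 3; omega
      have h2 := hg.1 j (n - j)
      rw [Nat.add_sub_cancel' hj] at h2
      rcases hX p (g ^ i • o) (g ^ (i + j : ℤ) • o) (g ^ (i + n : ℤ) • o) with h3 | h3
      · rw [e2, e3, dist_comm p (g ^ i • o)] at h3
        linarith [le_abs_self c, abs_nonneg c₁]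
      · rw [e1, e3] at h3
        linarith [le_abs_self c₁, abs_nonneg c]
  intro i k p h
  rcases le_total i k with hik | hik
  · exact key i k p hik h
  · refine key k i p hik ?_
    rw [dist_comm (g ^ k • o) p, dist_comm p (g ^ i • o), dist_comm (g ^ k • o) (g ^ i • o)]
    linarith

/-- The union of the axes of two loxodromic elements through `o` is quasiconvex. -/
theorem exists_isQuasiconvex_union (o : X) {g h : G} (hg : IsLoxodromic X g)
    (hh : IsLoxodromic X h) : ∃ Q : ℝ, 0 ≤ Q ∧
      IsQuasiconvex Q (range (fun n : ℤ => g ^ n • o) ∪ range fun n : ℤ => h ^ n • o) := by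
  obtain ⟨δ, hδ, hG⟩ := exists_isGromovHyp X
  have hX := hG.fourPoint
  obtain ⟨c, hc⟩ := hg.exists_hasAxis o
  obtain ⟨c', hc'⟩ := hh.exists_hasAxis o
  obtain ⟨R, hR0, hR⟩ := hc.exists_near (2 * δ)
  obtain ⟨R', hR0', hR'⟩ := hc'.exists_near (2 * δ)
  have ng : ∀ (i k : ℤ) (p : X),
      dist (g ^ i • o) p + dist p (g ^ k • o) ≤ dist (g ^ i • o) (g ^ k • o) + 2 * δ →
      ∃ z ∈ range (fun n : ℤ => g ^ n • o) ∪ range fun n : ℤ => h ^ n • o,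
        dist p z ≤ max R R' := fun i k p hp => by
    obtain ⟨j, hj⟩ := hR i k p hp
    exact ⟨_, Or.inl ⟨j, rfl⟩, hj.trans (le_max_left _ _)⟩
  have nh : ∀ (i k : ℤ) (p : X),
      dist (h ^ i • o) p + dist p (h ^ k • o) ≤ dist (h ^ i • o) (h ^ k • o) + 2 * δ →
      ∃ z ∈ range (fun n : ℤ => g ^ n • o) ∪ range fun n : ℤ => h ^ n • o,
        dist p z ≤ max R R' := fun i k p hp => by
    obtain ⟨j, hj⟩ := hR' i k p hp
    exact ⟨_, Or.inr ⟨j, rfl⟩, hj.trans (le_max_right _ _)⟩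
  refine ⟨max R R', hR0.trans (le_max_left _ _), ?_⟩
  rintro _ (⟨i, rfl⟩ | ⟨i, rfl⟩) _ (⟨k, rfl⟩ | ⟨k, rfl⟩) γ hγ p hp
  · exact ng i k p (by linarith [hγ.dist_add hp])
  -- Both axes pass through `o`, so the thin triangle with third vertex `o` reduces the mixed case
  -- to a single axis.
  · rcases hγ.thin hX hp o with h1 | h1
    · exact ng i 0 p (by simpa using h1)
    · exact nh 0 k p (by simpa using h1)
  · rcases hγ.thin hX hp o with h1 | h1
    · exact nh i 0 p (by simpa using h1)
    · exact ng 0 k p (by simpa using h1)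
  · exact nh i k p (by linarith [hγ.dist_add hp])

/-- If `k` preserves the pair of endpoints of `g`, then `k o` is close to the axis of `g`. -/
theorem exists_near_axis (o : X) {g : G} (hg : IsLoxodromic X g) :
    ∃ R : ℝ, ∀ k : G,
      (k • loxPoint o hg = loxPoint o hg ∧ k • loxPoint o hg.inv = loxPoint o hg.inv) ∨
        (k • loxPoint o hg = loxPoint o hg.inv ∧ k • loxPoint o hg.inv = loxPoint o hg) →
      ∃ j : ℤ, dist (k • o) (g ^ j • o) ≤ R := by
  obtain ⟨δ, hδ, hX⟩ := exists_isGromovHyp X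
  obtain ⟨c, hc⟩ := hg.exists_hasAxis o
  obtain ⟨R, -, hR⟩ := hc.exists_near (c + 4 * δ)
  refine ⟨R, fun k hk => ?_⟩
  -- The two ends of the translated axis have bounded Gromov product at `k • o`, and so have any
  -- sequences with the same limits. Thus `k • o` is coarsely between far points of the original
  -- axis.
  have key : ∀ x y : ℕ → X, Asymptotic (fun n => k • g ^ n • o) x →
      Asymptotic (fun n => k • g⁻¹ ^ n • o) y → ∃ n,
        dist (x n) (k • o) + dist (k • o) (y n) ≤ dist (x n) (y n) + (c + 4 * δ) := by
    intro x y hx hy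
    obtain ⟨N₁, h₁⟩ := (asymptotic_iff (k • o)).1 hx (c / 2 + 2 * δ + 1)
    obtain ⟨N₂, h₂⟩ := (asymptotic_iff (k • o)).1 hy (c / 2 + 2 * δ + 1)
    set n := max N₁ N₂
    have e1 := h₁ n (le_max_left _ _) n (le_max_left _ _)
    have e2 := h₂ n (le_max_right _ _) n (le_max_right _ _)
    have e3 : gromovProd (k • o) (k • g ^ n • o) (k • g⁻¹ ^ n • o) ≤ c / 2 := by
      have := hc.gromovProd_inv_le n n
      unfold gromovProd at this ⊢
      rwa [dist_smul, dist_smul, dist_smul]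
    refine ⟨n, ?_⟩
    have e4 : gromovProd (k • o) (x n) (y n) ≤ c / 2 + 2 * δ := by
      rcases hX.le_or (k • o) (k • g ^ n • o) (x n) (k • g⁻¹ ^ n • o) with h | h
      · linarith
      · rcases hX.le_or (k • o) (x n) (y n) (k • g⁻¹ ^ n • o) with h' | h'
        · linarith
        · rw [gromovProd_comm (k • o) (y n)] at h'
          linarith
    unfold gromovProd at e4
    rw [dist_comm (k • o) (y n)]
    linarith
  rcases hk with ⟨h1, h2⟩ | ⟨h1, h2⟩
  · obtain ⟨n, hn⟩ := key _ _ (Quotient.exact h1) (Quotient.exact h2)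
    exact hR n (-n) (k • o) (by simpa only [zpow_natCast, zpow_neg, inv_pow] using hn)
  · obtain ⟨n, hn⟩ := key _ _ (Quotient.exact h1) (Quotient.exact h2)
    exact hR (-n) n (k • o) (by simpa only [zpow_natCast, zpow_neg, inv_pow] using hn)

/-- A converging orbit sequence shadows powers of `g`: nonnegative ones infinitely often, or
negative ones from some index on. Either way infinitely many close points determine its limit. -/
theorem limitSet_subset_of_near_axis (o : X) {g : G} (hg : IsLoxodromic X g) (R : ℝ)
    (h : ∀ k : G, ∃ j : ℤ, dist (k • o) (g ^ j • o) ≤ R) :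
    limitSet G X ⊆ {loxPoint o hg, loxPoint o hg.inv} := by
  rintro ξ ⟨x, k, hk, rfl⟩
  choose j hj using h
  have hd : ∀ n, dist (k n • x) (g ^ j (k n) • o) ≤ dist x o + R := fun n => by
    refine (dist_triangle _ (k n • o) _).trans ?_
    rw [dist_smul]
    linarith [hj (k n)]
  by_cases hpos : ∀ N : ℕ, ∃ i ≥ N, 0 ≤ j (k i)
  · refine Or.inl (Quotient.sound (hg.asymptotic_of_near o hk (dist x o + R) fun N => ?_))
    obtain ⟨i, hi, h0⟩ := hpos N
    obtain ⟨m, hm⟩ := Int.eq_ofNat_of_zero_le h0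
    have := hd i
    rw [hm, zpow_natCast] at this
    exact ⟨i, hi, m, this⟩
  · push Not at hpos
    obtain ⟨N₀, hN₀⟩ := hpos
    refine Or.inr (Quotient.sound (hg.inv.asymptotic_of_near o hk (dist x o + R) fun N => ?_))
    have h0 := hN₀ (max N N₀) (le_max_right _ _)
    obtain ⟨m, hm⟩ := Int.eq_ofNat_of_zero_le (show 0 ≤ -j (k (max N N₀)) by omega)
    have := hd (max N N₀)
    rw [show j (k (max N N₀)) = -(m : ℤ) by omega, zpow_neg, zpow_natCast, ← inv_pow] at this
    exact ⟨max N N₀, le_max_left _ _, m, this⟩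

/-! ### Types of actions with a loxodromic element -/

theorem pair_subset_limitSet (o : X) {g : G} (hg : IsLoxodromic X g) :
    {loxPoint o hg, loxPoint o hg.inv} ⊆ limitSet G X := by
  rintro ξ (rfl | rfl)
  · exact loxPoint_mem_limitSet o hg
  · exact loxPoint_mem_limitSet o hg.inv

theorem two_le_encard_limitSet (o : X) {g : G} (hg : IsLoxodromic X g) :
    2 ≤ (limitSet G X).encard := by
  rw [← encard_pair (loxPoint_ne_inv o hg)]
  exact encard_le_encard (pair_subset_limitSet o hg)

/-- If the limit set has at most two points, it is the invariant pair of endpoints. Conversely,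
preserving the pair keeps the orbit near the axis. -/
theorem isElementary_iff (o : X) {g : G} (hg : IsLoxodromic X g) :
    IsElementary G X ↔ ∀ k : G,
      (k • loxPoint o hg = loxPoint o hg ∨ k • loxPoint o hg = loxPoint o hg.inv) ∧
        (k • loxPoint o hg.inv = loxPoint o hg ∨ k • loxPoint o hg.inv = loxPoint o hg.inv) := by
  have hne := loxPoint_ne_inv o hg
  constructor
  · intro h k
    have h1 : {loxPoint o hg, loxPoint o hg.inv} = limitSet G X :=
      (Set.toFinite _).eq_of_subset_of_encard_le (pair_subset_limitSet o hg)
        (by rw [encard_pair hne]; exact h)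
    have h2 := smul_mem_limitSet (loxPoint_mem_limitSet o hg) k
    have h3 := smul_mem_limitSet (loxPoint_mem_limitSet o hg.inv) k
    rw [← h1] at h2 h3
    exact ⟨h2, h3⟩
  · intro h
    obtain ⟨R, hR⟩ := exists_near_axis o hg
    refine (encard_le_encard (limitSet_subset_of_near_axis o hg R fun k => hR k ?_)).trans
      (encard_pair hne).le
    have hk : k • loxPoint o hg ≠ k • loxPoint o hg.inv := fun h => hne (smul_left_cancel k h)
    obtain ⟨h1 | h1, h2 | h2⟩ := h k
    · exact absurd (h1.trans h2.symm) hk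
    · exact Or.inl ⟨h1, h2⟩
    · exact Or.inr ⟨h1, h2⟩
    · exact absurd (h1.trans h2.symm) hk

theorem fixesBoundaryPoint_iff (o : X) {g : G} (hg : IsLoxodromic X g) :
    FixesBoundaryPoint G X ↔ (∀ k : G, k • loxPoint o hg = loxPoint o hg) ∨
      ∀ k : G, k • loxPoint o hg.inv = loxPoint o hg.inv := by
  constructor
  · rintro ⟨ξ, hξ⟩
    rcases eq_loxPoint_of_smul_eq o hg (fun n => hξ (g ^ n)) with rfl | rfl
    · exact Or.inl hξ
    · exact Or.inr hξ
  · rintro (h | h)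
    · exact ⟨_, h⟩
    · exact ⟨_, h⟩

/-- Long displacements have large Gromov products, so any two orbit sequences going to infinity are
asymptotic. -/
theorem limitSet_subsingleton_of_not_isLoxodromic (hG : ∀ g : G, ¬ IsLoxodromic X g) :
    (limitSet G X).Subsingleton := by
  rintro _ ⟨x, g, hg, rfl⟩ _ ⟨y, h, hh, rfl⟩
  obtain ⟨δ, hδ, hX⟩ := exists_isGromovHyp X
  refine Quotient.sound ((asymptotic_iff x).2 fun M => ?_)
  obtain ⟨N₁, h₁⟩ := hg.exists_le_dist x (2 * M + 2 * dist y x + (6 * δ + 1))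
  obtain ⟨N₂, h₂⟩ := hh.exists_le_dist x (2 * M + 3 * dist y x + (6 * δ + 1))
  refine ⟨max N₁ N₂, fun i hi j hj => ?_⟩
  have e1 := h₁ i ((le_max_left _ _).trans hi)
  have e2 := h₂ j ((le_max_right _ _).trans hj)
  have e3 := min_dist_le_of_not_isLoxodromic hX hG x (g i) (h j)
  have e4 := gromovProd_le_add x (g i • x) (h j • x) (g i • x) (h j • y)
  rw [dist_self, dist_smul, zero_add, dist_comm x y] at e4
  have e5 := dist_triangle (h j • y) (h j • x) x
  rw [dist_smul] at e5
  rw [dist_comm x, dist_comm x] at e3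
  rcases min_le_iff.1 e3 with e | e <;> linarith

theorem limitSet_eq_empty_of_bounded (o : X) (B : ℝ) (h : ∀ g : G, dist o (g • o) ≤ B) :
    limitSet G X = ∅ := by
  refine eq_empty_of_forall_notMem ?_
  rintro _ ⟨x, g, hg, -⟩
  obtain ⟨N, hN⟩ := hg.exists_le_dist o (dist x o + B + 1)
  have h1 := hN N le_rfl
  have h2 := dist_triangle (g N • x) (g N • o) o
  rw [dist_smul, dist_comm (g N • o) o] at h2
  linarith [h (g N)]

theorem exists_isLoxodromic (h0 : ¬ HasType G X .elliptic) (h1 : ¬ HasType G X .horocyclic) :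
    ∃ g : G, IsLoxodromic X g := by
  by_contra! hG
  have h2 := encard_le_one_iff_subsingleton.2 (limitSet_subsingleton_of_not_isLoxodromic hG)
  rcases h2.lt_or_eq with h | h
  · exact h0 (Order.lt_one_iff.1 h)
  · exact h1 h

end

/-! ### Comparison of the types of two actions -/

/-- This reduces a condition on all of `G` to a single element, so that one `Q` can serve. -/
theorem exists_imp_forall {α : Type u} [Nonempty α] (p : α → Prop) : ∃ a, p a → ∀ b, p b := by
  by_cases h : ∀ b, p b
  · exact ⟨Classical.arbitrary α, fun _ => h⟩
  · push Not at h
    exact h.imp fun a ha ha' => absurd ha' ha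

section

variable {G : Type u} [Group G]
  {X : Type v} [MetricSpace X] [MulAction G X] [IsIsometricSMul G X]
  {Y : Type w} [MetricSpace Y] [MulAction G Y] [IsIsometricSMul G Y]

theorem IsLoxodromic.transfer {g : G} (hg : IsLoxodromic X g) (o : X) (y : Y) {C : ℝ} (hC : 0 < C)
    (H : ∀ n : ℕ, dist o (g ^ n • o) ≤ C * dist y (g ^ n • y) + C) : IsLoxodromic Y g := by
  obtain ⟨ε, hε, D, h⟩ := (isLoxodromic_iff g o).1 hg
  refine (isLoxodromic_iff g y).2 ⟨ε / C, by positivity, (D + C) / C, fun n => ?_⟩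
  rw [div_mul_eq_mul_div, ← sub_div, div_le_iff₀ hC]
  linarith [h n, H n]

theorem not_isLoxodromic_of_bounded (o : X) (B : ℝ) (h : ∀ g : G, dist o (g • o) ≤ B) (g : G) :
    ¬ IsLoxodromic X g := by
  intro hg
  obtain ⟨ε, hε, C, hC⟩ := (isLoxodromic_iff g o).1 hg
  obtain ⟨n, hn⟩ := exists_nat_gt ((B + C) / ε)
  rw [div_lt_iff₀ hε] at hn
  linarith [hC n, h (g ^ n)]

variable [IsHyperbolicSpace X]

theorem hasType_iff_of_isLoxodromic (o : X) {g : G} (hg : IsLoxodromic X g) (t : ActionType) :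
    HasType G X t ↔ match t with
      | .elliptic => False
      | .horocyclic => False
      | .lineal => IsElementary G X
      | .focal => ¬ IsElementary G X ∧ FixesBoundaryPoint G X
      | .generalType => ¬ IsElementary G X ∧ ¬ FixesBoundaryPoint G X := by
  have h2 := two_le_encard_limitSet o hg
  cases t with
  | elliptic =>
    refine iff_false_intro fun h => ?_
    rw [show (limitSet G X).encard = 0 from h] at h2
    exact absurd h2 (by norm_num)
  | horocyclic =>
    refine iff_false_intro fun h => ?_
    rw [show (limitSet G X).encard = 1 from h] at h2
    exact absurd h2 (by norm_num)
  | lineal => exact ⟨fun h => le_of_eq h, fun h => le_antisymm h h2⟩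
  | focal => exact Iff.rfl
  | generalType => exact Iff.rfl

variable [IsHyperbolicSpace Y]

theorem loxPoint_eq_transfer (o : X) (y : Y) {g h : G} {hg : IsLoxodromic X g}
    {hh : IsLoxodromic X h} {hg' : IsLoxodromic Y g} {hh' : IsLoxodromic Y h} {C : ℝ} (hC : 0 ≤ C)
    (H : ∀ n m : ℕ, dist (g ^ n • y) (h ^ m • y) ≤ C * dist (g ^ n • o) (h ^ m • o) + C)
    (heq : loxPoint o hg = loxPoint o hh) : loxPoint y hg' = loxPoint y hh' := by
  obtain ⟨R, hR⟩ := exists_near_of_loxPoint_eq o hg hh heq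
  refine loxPoint_eq_of_near y hg' hh' (C * R + C) fun n => ?_
  obtain ⟨m, hm⟩ := hR n
  exact ⟨m, (H n m).trans (by linarith [mul_le_mul_of_nonneg_left hm hC])⟩

/-- If `k` maps an endpoint of `g` to an endpoint of `g` in the boundary of `X`, it does so in the
boundary of `Y`. -/
def EndpointsTransfer (o : X) (y : Y) {g : G} (hg : IsLoxodromic X g) (hg' : IsLoxodromic Y g)
    (k : G) : Prop :=
  (k • loxPoint o hg = loxPoint o hg → k • loxPoint y hg' = loxPoint y hg') ∧
  (k • loxPoint o hg = loxPoint o hg.inv → k • loxPoint y hg' = loxPoint y hg'.inv) ∧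
  (k • loxPoint o hg.inv = loxPoint o hg → k • loxPoint y hg'.inv = loxPoint y hg') ∧
  (k • loxPoint o hg.inv = loxPoint o hg.inv → k • loxPoint y hg'.inv = loxPoint y hg'.inv)

theorem endpointsTransfer_of_dist_le (o : X) (y : Y) {g : G} (hg : IsLoxodromic X g)
    (hg' : IsLoxodromic Y g) (k : G) {C : ℝ} (hC : 0 ≤ C)
    (H : ∀ n m : ℤ, dist ((k * g * k⁻¹) ^ n • y) (g ^ m • y) ≤
      C * dist ((k * g * k⁻¹) ^ n • o) (g ^ m • o) + C) :
    EndpointsTransfer o y hg hg' k := by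
  have e1 : ∀ n : ℕ, (k * g * k⁻¹) ^ n = (k * g * k⁻¹) ^ (n : ℤ) := fun n => (zpow_natCast _ n).symm
  have e2 : ∀ n : ℕ, (k * g⁻¹ * k⁻¹) ^ n = (k * g * k⁻¹) ^ (-(n : ℤ)) := fun n => by
    rw [zpow_neg, zpow_natCast, ← inv_pow]; congr 1; group
  have e3 : ∀ n : ℕ, g ^ n = g ^ (n : ℤ) := fun n => (zpow_natCast _ n).symm
  have e4 : ∀ n : ℕ, g⁻¹ ^ n = g ^ (-(n : ℤ)) := fun n => by
    rw [zpow_neg, zpow_natCast, ← inv_pow]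
  unfold EndpointsTransfer
  simp only [smul_loxPoint]
  refine ⟨?_, ?_, ?_, ?_⟩ <;> refine loxPoint_eq_transfer o y hC fun n m => ?_
  · simp only [e1, e3]; exact H _ _
  · simp only [e1, e4]; exact H _ _
  · simp only [e2, e3]; exact H _ _
  · simp only [e2, e4]; exact H _ _

/-- Coincidences of endpoints pass from `X` to `Y` for every `k`, but back only for the three
deciding elements; these suffice for the universal statements in `X`. -/
theorem isElementary_iff_and_fixesBoundaryPoint_iff (o : X) (y : Y) {g : G}
    (hg : IsLoxodromic X g) (hg' : IsLoxodromic Y g)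
    (hXY : ∀ k, EndpointsTransfer o y hg hg' k) {k₁ k₂ k₃ : G}
    (h₁ : EndpointsTransfer y o hg' hg k₁) (h₂ : EndpointsTransfer y o hg' hg k₂)
    (h₃ : EndpointsTransfer y o hg' hg k₃)
    (hk₁ : k₁ • loxPoint o hg = loxPoint o hg → ∀ k : G, k • loxPoint o hg = loxPoint o hg)
    (hk₂ : k₂ • loxPoint o hg.inv = loxPoint o hg.inv →
      ∀ k : G, k • loxPoint o hg.inv = loxPoint o hg.inv)
    (hk₃ : ((k₃ • loxPoint o hg = loxPoint o hg ∨ k₃ • loxPoint o hg = loxPoint o hg.inv) ∧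
        (k₃ • loxPoint o hg.inv = loxPoint o hg ∨ k₃ • loxPoint o hg.inv = loxPoint o hg.inv)) →
      ∀ k : G, (k • loxPoint o hg = loxPoint o hg ∨ k • loxPoint o hg = loxPoint o hg.inv) ∧
        (k • loxPoint o hg.inv = loxPoint o hg ∨ k • loxPoint o hg.inv = loxPoint o hg.inv)) :
    (IsElementary G X ↔ IsElementary G Y) ∧ (FixesBoundaryPoint G X ↔ FixesBoundaryPoint G Y) := by
  rw [isElementary_iff o hg, isElementary_iff y hg', fixesBoundaryPoint_iff o hg,
    fixesBoundaryPoint_iff y hg']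
  refine ⟨⟨fun h k => ?_, fun h => hk₃ ?_⟩, ⟨fun h => ?_, fun h => ?_⟩⟩
  · exact ⟨(h k).1.imp (hXY k).1 (hXY k).2.1, (h k).2.imp (hXY k).2.2.1 (hXY k).2.2.2⟩
  · exact ⟨(h k₃).1.imp h₃.1 h₃.2.1, (h k₃).2.imp h₃.2.2.1 h₃.2.2.2⟩
  · exact h.imp (fun h k => (hXY k).1 (h k)) (fun h k => (hXY k).2.2.2 (h k))
  · exact h.imp (fun h => hk₁ (h₁.1 (h k₁))) (fun h => hk₂ (h₂.2.2.2 (h k₂)))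

end

theorem IsQuasiconvex.mono {X : Type v} [MetricSpace X] {Q Q' : ℝ} {Z : Set X}
    (h : IsQuasiconvex Q Z) (hQ : Q ≤ Q') : IsQuasiconvex Q' Z :=
  fun x hx y hy γ hγ p hp => (h x hx y hy γ hγ p hp).imp fun _ h => ⟨h.1, h.2.trans hQ⟩

/-- An action with a loxodromic element `g` has a cobounded companion of the same type in which
`g` is loxodromic. -/
theorem exists_cobounded_of_isLoxodromic {G : Type u} [Group G] {X : Type v} [MetricSpace X]
    [MulAction G X] [IsIsometricSMul G X] [IsHyperbolicSpace X] {g : G} (hg : IsLoxodromic X g) :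
    ∃ (Y : Type v) (_ : MetricSpace Y) (_ : MulAction G Y) (_ : IsIsometricSMul G Y)
      (_ : IsHyperbolicSpace Y), IsCobounded G Y ∧ IsLoxodromic Y g ∧
        ∀ t : ActionType, HasType G X t ↔ HasType G Y t := by
  obtain ⟨o⟩ := IsHyperbolicSpace.nonempty (X := X)
  -- Each `kᵢ` violates its condition whenever some element of `G` does.
  obtain ⟨k₁, hk₁⟩ := exists_imp_forall fun k : G => k • loxPoint o hg = loxPoint o hg
  obtain ⟨k₂, hk₂⟩ := exists_imp_forall fun k : G => k • loxPoint o hg.inv = loxPoint o hg.inv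
  obtain ⟨k₃, hk₃⟩ := exists_imp_forall fun k : G =>
    (k • loxPoint o hg = loxPoint o hg ∨ k • loxPoint o hg = loxPoint o hg.inv) ∧
      (k • loxPoint o hg.inv = loxPoint o hg ∨ k • loxPoint o hg.inv = loxPoint o hg.inv)
  choose Q hQ0 hQ using fun k : G => exists_isQuasiconvex_union o (hg.conj k) hg
  obtain ⟨K, hK, Y, _, _, _, _, π, hcob, hπ, ⟨L, hL⟩, hqi, -⟩ :=
    exists_cobounded G X o (max (Q k₁) (max (Q k₂) (Q k₃)))
      ((hQ0 k₁).trans (le_max_left _ _))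
  have hL0 : 0 ≤ L := by simpa using hL o o
  have hC : 0 < K + K * K := by positivity
  -- The quasi-isometric embedding applies to the union of the two axes, not just to each of them.
  -- This is what lets closeness of axes in `Y` be pulled back to `X`.
  have back : ∀ k : G, Q k ≤ max (Q k₁) (max (Q k₂) (Q k₃)) → ∀ n m : ℤ,
      dist ((k * g * k⁻¹) ^ n • o) (g ^ m • o) ≤
        (K + K * K) * dist ((k * g * k⁻¹) ^ n • π o) (g ^ m • π o) + (K + K * K) := by
    intro k hk n m
    have hZ : (range (fun n : ℤ => (k * g * k⁻¹) ^ n • o) ∪ range fun n : ℤ => g ^ n • o) ⊆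
        MulAction.orbit G o := by
      rintro _ (⟨n, rfl⟩ | ⟨n, rfl⟩) <;> exact ⟨_, rfl⟩
    have h1 := ((hqi _ hZ ((hQ k).mono hk)).2 ⟨_, Or.inl ⟨n, rfl⟩⟩ ⟨_, Or.inr ⟨m, rfl⟩⟩).1
    rw [Subtype.dist_eq] at h1
    simp only [hπ] at h1
    rw [sub_le_iff_le_add, inv_mul_le_iff₀ hK] at h1
    have h2 := mul_nonneg (mul_nonneg hK.le hK.le)
      (dist_nonneg (x := (k * g * k⁻¹) ^ n • π o) (y := g ^ m • π o))
    linarith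
  have q₁ : Q k₁ ≤ max (Q k₁) (max (Q k₂) (Q k₃)) := le_max_left _ _
  have q₂ : Q k₂ ≤ max (Q k₁) (max (Q k₂) (Q k₃)) := (le_max_left _ _).trans (le_max_right _ _)
  have q₃ : Q k₃ ≤ max (Q k₁) (max (Q k₂) (Q k₃)) := (le_max_right _ _).trans (le_max_right _ _)
  have hgY : IsLoxodromic Y g := hg.transfer o (π o) hC fun n => by
    simpa using back k₁ q₁ 0 n
  have hXY : ∀ k, EndpointsTransfer o (π o) hg hgY k := fun k =>
    endpointsTransfer_of_dist_le o (π o) hg hgY k hL0 fun n m => by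
      rw [← hπ, ← hπ]; exact hL _ _
  have hYX : ∀ k, Q k ≤ max (Q k₁) (max (Q k₂) (Q k₃)) → EndpointsTransfer (π o) o hgY hg k :=
    fun k hk => endpointsTransfer_of_dist_le (π o) o hgY hg k hC.le (back k hk)
  have h := isElementary_iff_and_fixesBoundaryPoint_iff o (π o) hg hgY hXY (hYX k₁ q₁) (hYX k₂ q₂)
    (hYX k₃ q₃) hk₁ hk₂ hk₃
  refine ⟨Y, inferInstance, inferInstance, inferInstance, inferInstance, hcob, hgY, fun t => ?_⟩
  rw [hasType_iff_of_isLoxodromic o hg, hasType_iff_of_isLoxodromic (π o) hgY]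
  cases t <;> simp only [h.1, h.2]

/-! ### Cobounded actions are elliptic or have a loxodromic element -/

section

variable {G : Type u} [Group G] {X : Type v} [MetricSpace X] [MulAction G X] [IsIsometricSMul G X]
  [IsHyperbolicSpace X]

theorem hasType_iff_of_elliptic (h : HasType G X .elliptic) (t : ActionType) :
    HasType G X t ↔ t = .elliptic := by
  have h0 : (limitSet G X).encard = 0 := h
  have he : IsElementary G X := by unfold IsElementary; rw [h0]; exact zero_le
  cases t <;> simp [HasType, h0, he]

theorem exists_dist_le_of_elliptic (hc : IsCobounded G X) (h : HasType G X .elliptic) :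
    ∃ B : ℝ, ∀ x y : X, dist x y ≤ B := by
  obtain ⟨o⟩ := IsHyperbolicSpace.nonempty (X := X)
  exact exists_dist_le_of_not_isLoxodromic hc fun g hg =>
    (hasType_iff_of_isLoxodromic o hg .elliptic).1 h

/-- A cobounded action without loxodromics lives on a bounded space, so its limit set is empty; in
particular it is never horocyclic. -/
theorem hasType_elliptic_or_isLoxodromic (hc : IsCobounded G X) :
    HasType G X .elliptic ∨ ∃ g : G, IsLoxodromic X g := by
  by_cases h : ∃ g : G, IsLoxodromic X g
  · exact Or.inr h
  · push Not at h
    obtain ⟨o⟩ := IsHyperbolicSpace.nonempty (X := X)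
    obtain ⟨B, hB⟩ := exists_dist_le_of_not_isLoxodromic hc h
    left
    show (limitSet G X).encard = 0
    rw [limitSet_eq_empty_of_bounded o B fun g => hB _ _, encard_empty]

end

theorem exists_cobounded_hasType (G : Type u) [Group G] (X : Type v) [MetricSpace X]
    [MulAction G X] [IsIsometricSMul G X] [IsHyperbolicSpace X] (h : ¬ HasType G X .horocyclic) :
    ∃ (Y : Type v) (_ : MetricSpace Y) (_ : MulAction G Y) (_ : IsIsometricSMul G Y)
      (_ : IsHyperbolicSpace Y), IsCobounded G Y ∧
        ∀ t : ActionType, HasType G X t ↔ HasType G Y t := by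
  -- An elliptic action is replaced by the action on a point; all other non-horocyclic ones contain
  -- a loxodromic element.
  by_cases h0 : HasType G X .elliptic
  · have i1 : IsIsometricSMul G PUnit.{v + 1} := ⟨fun _ _ _ => rfl⟩
    have i2 := point_isHyperbolicSpace.{v}
    refine ⟨PUnit.{v + 1}, inferInstance, inferInstance, i1, i2,
      ⟨PUnit.unit, 0, fun _ => ⟨1, (dist_self _).le⟩⟩, fun t => ?_⟩
    have h1 : HasType G PUnit.{v + 1} .elliptic := by
      show (limitSet G PUnit.{v + 1}).encard = 0
      rw [limitSet_eq_empty_of_bounded PUnit.unit 0 fun g => (dist_self _).le, encard_empty]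
    rw [hasType_iff_of_elliptic h0, hasType_iff_of_elliptic h1]
  · obtain ⟨g, hg⟩ := exists_isLoxodromic h0 h
    obtain ⟨Y, _, _, _, _, hc, -, ht⟩ := exists_cobounded_of_isLoxodromic hg
    exact ⟨Y, inferInstance, inferInstance, inferInstance, inferInstance, hc, ht⟩

/-! ### Hyperbolic structures -/

namespace CoboundedAction

variable {G : Type u} [Group G] {A B : CoboundedAction.{u, v} G}

theorem Dominated.hasType_elliptic (h : Dominated A B) (hB : HasType G B.carrier .elliptic) :
    HasType G A.carrier .elliptic := by
  obtain ⟨D, hD⟩ := exists_dist_le_of_elliptic B.cobounded hB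
  obtain ⟨a⟩ := IsHyperbolicSpace.nonempty (X := A.carrier)
  obtain ⟨b⟩ := IsHyperbolicSpace.nonempty (X := B.carrier)
  obtain ⟨C, hC, h⟩ := h.forall a b
  show (limitSet G A.carrier).encard = 0
  rw [limitSet_eq_empty_of_bounded a (C * D + C) fun g => ?_, encard_empty]
  linarith [h g, mul_le_mul_of_nonneg_left (hD b (g • b)) hC.le]

/-- Mutual domination compares all orbit distances in both directions, so loxodromics and
coincidences of their endpoints agree in both actions. -/
theorem Equivalent.hasType_iff (h : Equivalent A B) (t : ActionType) :
    HasType G A.carrier t ↔ HasType G B.carrier t := by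
  obtain ⟨hAB, hBA⟩ := (equivalent_iff A B).1 h
  rcases hasType_elliptic_or_isLoxodromic A.cobounded with hA | ⟨g, hg⟩
  · rw [hasType_iff_of_elliptic hA, hasType_iff_of_elliptic (hBA.hasType_elliptic hA)]
  · obtain ⟨a⟩ := IsHyperbolicSpace.nonempty (X := A.carrier)
    obtain ⟨b⟩ := IsHyperbolicSpace.nonempty (X := B.carrier)
    obtain ⟨C, hC, h⟩ := hAB.forall a b
    obtain ⟨C', hC', h'⟩ := hBA.forall b a
    have hg' : IsLoxodromic B.carrier g := hg.transfer a b hC fun n => h _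
    have hT : ∀ k, EndpointsTransfer a b hg hg' k := fun k =>
      endpointsTransfer_of_dist_le a b hg hg' k hC'.le fun n m => by
        rw [dist_smul_smul, dist_smul_smul]; exact h' _
    have hT' : ∀ k, EndpointsTransfer b a hg' hg k := fun k =>
      endpointsTransfer_of_dist_le b a hg' hg k hC.le fun n m => by
        rw [dist_smul_smul, dist_smul_smul]; exact h _
    obtain ⟨k₁, hk₁⟩ := exists_imp_forall fun k : G => k • loxPoint a hg = loxPoint a hg
    obtain ⟨k₂, hk₂⟩ := exists_imp_forall fun k : G => k • loxPoint a hg.inv = loxPoint a hg.inv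
    obtain ⟨k₃, hk₃⟩ := exists_imp_forall fun k : G =>
      (k • loxPoint a hg = loxPoint a hg ∨ k • loxPoint a hg = loxPoint a hg.inv) ∧
        (k • loxPoint a hg.inv = loxPoint a hg ∨ k • loxPoint a hg.inv = loxPoint a hg.inv)
    have hEF := isElementary_iff_and_fixesBoundaryPoint_iff a b hg hg' hT (hT' k₁) (hT' k₂)
      (hT' k₃) hk₁ hk₂ hk₃
    rw [hasType_iff_of_isLoxodromic a hg, hasType_iff_of_isLoxodromic b hg']
    cases t <;> simp only [hEF.1, hEF.2]

end CoboundedAction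

namespace HyperbolicStructures

variable {G : Type u} [Group G]

theorem mk_mem_ofType (A : CoboundedAction.{u, v} G) (t : ActionType) :
    (Quotient.mk (CoboundedAction.setoid G) A : HyperbolicStructures.{u, v} G) ∈ ofType G t ↔
      HasType G A.carrier t := by
  constructor
  · rintro ⟨B, hB, ht⟩
    exact (CoboundedAction.Equivalent.hasType_iff (Quotient.exact hB) t).2 ht
  · exact fun h => ⟨A, rfl, h⟩

end HyperbolicStructures

/-! ### The criteria for (NGT), (NNE) and (NL) -/

variable (G : Type u) [Group G]

theorem ngt_iff :
    NGT.{u, v} G ↔ HyperbolicStructures.ofType.{u, v} G .generalType = ∅ := by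
  constructor
  · intro h
    refine eq_empty_of_forall_notMem ?_
    rintro _ ⟨A, -, hA⟩
    exact h A.carrier hA
  · intro h X _ _ _ _ hX
    obtain ⟨Y, _, _, _, _, hc, ht⟩ := exists_cobounded_hasType G X fun h1 => by
      have h2 : (limitSet G X).encard = 1 := h1
      refine hX.1 ?_
      unfold IsElementary
      rw [h2]
      norm_num
    have : Quotient.mk (CoboundedAction.setoid G) ⟨Y, hc⟩ ∈
        HyperbolicStructures.ofType.{u, v} G .generalType := ⟨⟨Y, hc⟩, rfl, (ht _).1 hX⟩
    rw [h] at this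
    exact this

theorem nne_iff :
    NNE.{u, v} G ↔
      (Set.univ : Set (HyperbolicStructures.{u, v} G)) =
          HyperbolicStructures.ofType G .elliptic ∪ HyperbolicStructures.ofType G .lineal ∧
        Disjoint (HyperbolicStructures.ofType.{u, v} G .elliptic)
          (HyperbolicStructures.ofType.{u, v} G .lineal) := by
  constructor
  · intro h
    refine ⟨(eq_univ_of_forall fun c => ?_).symm, ?_⟩
    · induction c using Quotient.inductionOn with
      | h A =>
        rcases hasType_elliptic_or_isLoxodromic A.cobounded with hA | ⟨g, hg⟩
        · exact Or.inl ⟨A, rfl, hA⟩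
        · obtain ⟨o⟩ := IsHyperbolicSpace.nonempty (X := A.carrier)
          exact Or.inr ⟨A, rfl, (hasType_iff_of_isLoxodromic o hg .lineal).2 (h A.carrier)⟩
    · rw [Set.disjoint_left]
      intro c
      induction c using Quotient.inductionOn with
      | h A =>
        intro h1 h2
        have h3 := (HyperbolicStructures.mk_mem_ofType A _).1 h1
        have h4 := (HyperbolicStructures.mk_mem_ofType A _).1 h2
        exact absurd ((hasType_iff_of_elliptic h3 _).1 h4) (by simp)
  · rintro ⟨h, -⟩ X _ _ _ _
    by_contra hX
    obtain ⟨Y, _, _, _, _, hc, ht⟩ := exists_cobounded_hasType G X fun h1 => by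
      have h2 : (limitSet G X).encard = 1 := h1
      refine hX ?_
      unfold IsElementary
      rw [h2]
      norm_num
    -- A non-elementary action is focal or of general type, and either type carries non-elementarity
    -- over to `Y`.
    have hY : ¬ IsElementary G Y := by
      by_cases hf : FixesBoundaryPoint G X
      · exact ((ht .focal).1 ⟨hX, hf⟩).1
      · exact ((ht .generalType).1 ⟨hX, hf⟩).1
    have : (Quotient.mk (CoboundedAction.setoid G) ⟨Y, hc⟩ : HyperbolicStructures.{u, v} G) ∈
        HyperbolicStructures.ofType G .elliptic ∪ HyperbolicStructures.ofType G .lineal :=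
      h ▸ mem_univ _
    refine hY ?_
    rcases this with h1 | h1
    · have h2 : (limitSet G Y).encard = 0 := (HyperbolicStructures.mk_mem_ofType _ _).1 h1
      exact h2.le.trans zero_le
    · have h2 : (limitSet G Y).encard = 2 := (HyperbolicStructures.mk_mem_ofType _ _).1 h1
      exact h2.le

/-- Cobounded actions without loxodromics are bounded, hence equivalent to a point. Conversely, a
loxodromic element stays loxodromic in the cobounded companion, which is then unbounded. -/
theorem nl_iff :
    NL.{u, v} G ↔ (Set.univ : Set (HyperbolicStructures.{u, v} G)) = {trivialStructure G} := by
  constructor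
  · intro h
    refine (eq_singleton_iff_unique_mem.2 ⟨mem_univ _, fun c _ => ?_⟩)
    induction c using Quotient.inductionOn with
    | h A =>
      obtain ⟨B, hB⟩ := exists_dist_le_of_not_isLoxodromic A.cobounded fun g => h A.carrier g
      obtain ⟨a⟩ := IsHyperbolicSpace.nonempty (X := A.carrier)
      refine Quotient.sound ((CoboundedAction.equivalent_iff _ _).2
        ⟨⟨a, PUnit.unit, B, fun g => ?_⟩, ⟨PUnit.unit, a, 0, fun g => ?_⟩⟩)
      · refine (hB _ _).trans ?_
        show B ≤ B * dist PUnit.unit.{v + 1} PUnit.unit + B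
        rw [dist_self]; simp
      · show dist PUnit.unit.{v + 1} PUnit.unit ≤ _
        rw [dist_self]; simp
  · intro h X _ _ _ _ g hg
    obtain ⟨Y, _, _, _, _, hc, hgY, -⟩ := exists_cobounded_of_isLoxodromic hg
    have h1 : (Quotient.mk (CoboundedAction.setoid G) ⟨Y, hc⟩ : HyperbolicStructures.{u, v} G) ∈
        ({trivialStructure G} : Set (HyperbolicStructures.{u, v} G)) := h ▸ mem_univ _
    obtain ⟨⟨a, b, C, hab⟩, -⟩ := (CoboundedAction.equivalent_iff _ _).1 (Quotient.exact h1)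
    refine not_isLoxodromic_of_bounded (X := Y) a C (fun k => (hab k).trans ?_) g hgY
    show C * dist PUnit.unit.{v + 1} PUnit.unit + C ≤ C
    rw [dist_self]; simp

end HypAct

end

theorem mainTheorem10 (G : Type u) [Group G] :
    -- passing to a cobounded action
    (∀ (X : Type v) [MetricSpace X] [MulAction G X] [IsIsometricSMul G X]
        [HypAct.IsHyperbolicSpace X] (o : X) (Q : ℝ), 0 ≤ Q →
      ∃ K : ℝ, 0 < K ∧
      ∃ (Y : Type v) (_ : MetricSpace Y) (_ : MulAction G Y) (_ : IsIsometricSMul G Y)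
        (_ : HypAct.IsHyperbolicSpace Y) (π : X → Y),
        HypAct.IsCobounded G Y ∧
        (∀ (g : G) (x : X), π (g • x) = g • π x) ∧
        HypAct.IsCoarselyLipschitz π ∧
        (∀ Z : Set X, Z ⊆ MulAction.orbit G o → HypAct.IsQuasiconvex Q Z →
          HypAct.IsQIEmbedding K K (fun z : Z => π z)) ∧
        ∃ D : ℝ, ∀ (x y : X) (γ : ℝ → X), HypAct.IsGeodesic γ x y →
          ∀ γ' : ℝ → Y, HypAct.IsGeodesic γ' (π x) (π y) →
            Metric.hausdorffEDist (π '' HypAct.segment γ x y)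
              (HypAct.segment γ' (π x) (π y)) ≤ ENNReal.ofReal D) ∧
    -- preservation of the type of a non-horocyclic action
    (∀ (X : Type v) [MetricSpace X] [MulAction G X] [IsIsometricSMul G X]
        [HypAct.IsHyperbolicSpace X], ¬ HypAct.HasType G X .horocyclic →
      ∃ (Y : Type v) (_ : MetricSpace Y) (_ : MulAction G Y) (_ : IsIsometricSMul G Y)
        (_ : HypAct.IsHyperbolicSpace Y),
        HypAct.IsCobounded G Y ∧
        ∀ t : HypAct.ActionType, HypAct.HasType G X t ↔ HypAct.HasType G Y t) ∧
    -- consequences for the poset of hyperbolic structures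
    (HypAct.NGT.{u, v} G ↔ HypAct.HyperbolicStructures.ofType.{u, v} G .generalType = ∅) ∧
    (HypAct.NNE.{u, v} G ↔
      (Set.univ : Set (HypAct.HyperbolicStructures.{u, v} G)) =
          HypAct.HyperbolicStructures.ofType G .elliptic ∪
            HypAct.HyperbolicStructures.ofType G .lineal ∧
        Disjoint (HypAct.HyperbolicStructures.ofType.{u, v} G .elliptic)
          (HypAct.HyperbolicStructures.ofType.{u, v} G .lineal)) ∧
    (HypAct.NL.{u, v} G ↔
      (Set.univ : Set (HypAct.HyperbolicStructures.{u, v} G)) = {HypAct.trivialStructure G}) := by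
  exact ⟨fun X _ _ _ _ o Q hQ => HypAct.exists_cobounded G X o Q hQ,
    fun X _ _ _ _ h => HypAct.exists_cobounded_hasType G X h,
    HypAct.ngt_iff G, HypAct.nne_iff G, HypAct.nl_iff G⟩
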